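/- Let $(X,d,\mu)$ be a generalized metric measure space, i.e. $X$ is a set with a metric $d$ that may take the value $+\infty$ and with a $\sigma$-finite measure $\mu$ (on some $\sigma$-algebra). Let $r\in[1,\infty)$, $1/r+1/r'=1$, and let $A$ be a (closed, densely defined) linear operator on the complex space $L^r(X)$ that generates a bounded analytic strongly continuous semigroup $(\mathrm e^{tA})_{t\ge0}$. Let $A'$ be the adjoint of $A$ on $L^{r'}(X)$ with respect to the pairing $\langle f,g\rangle=\int_X fg\,d\mu$, and for an operator $B$ put $\|f\|_{B}:=\|f\|+\|Bf\|$ for $f\in D(B)$. Let $C^{0,\alpha}(X)$ be the space of bounded $\alpha$-Hölder continuous functions $u:X\to\mathbb C$, with norm $\|u\|_\infty+\sup_{x\ne x'}|u(x)-u(x')|/d(x,x')^\alpha$. Suppose that for some integer $k\ge1$ and some $\alpha\in(0,1]$ the space $(D(A^k),\|\cdot\|_{A^k})$ is continuously embedded into $C^{0,\alpha}(X)$, i.e. there is a bounded linear map $J:D(A^k)\to C^{0,\alpha}(X)$ such that $Jf=f$ $\mu$-a.e. for every $f\in D(A^k)$. Then the semigroup has a heat kernel $p$, i.e. there is a function $p:(0,\infty)\times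 X\times X\to\mathbb C$ such that for every $t>0$ the function $p_t$ is measurable with respect to the completed product measure and, for all $f\in L^r(X)$ and a.e. $x\in X$, $p_t(x,\cdot)f\in L^1(X)$ and $$(\mathrm e^{tA}f)(x)=\int_X p_t(x,y)f(y)\,d\mu(y);$$ and $p$ can be chosen such that $p_t(x,\cdot)\in D(A')$ for all $t>0$ and every $x\in X$, and such that there are constants $C_1,C_2>0$ with $$\|p_t(x,\cdot)-p_t(x',\cdot)\|_{A'}\le\bigl(C_1+C_2t^{-(k+1)}\bigr)\,d(x,x')^\alpha\qquad\text{for all }t>0\text{ and all }x,x'\in X.$$ -/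

import Mathlib

open MeasureTheory Filter Topology
open scoped ENNReal NNReal

noncomputable section

namespace HeatKernel

section Operators

variable {E : Type*} [NormedAddCommGroup E] [NormedSpace ℂ E]

/-- The composition `B ∘ C` of two unbounded operators on its natural domain
`{f ∈ D(C) | C f ∈ D(B)}`. -/
def opComp (B C : E →ₗ.[ℂ] E) : E →ₗ.[ℂ] E :=
  B.comp (C.domRestrict ((B.domain.comap C.toFun).map C.domain.subtype)) (by
    rintro ⟨x, hx⟩
    obtain ⟨⟨y, hy, rfl⟩, hx'⟩ := hx
    exact hy)

/-- The powers `A ^ k` of an unbounded operator: `A ^ 0` is the identity on the whole space and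
`D(A ^ (k + 1)) = {f ∈ D(A ^ k) | A ^ k f ∈ D(A)}`. -/
def opPow (A : E →ₗ.[ℂ] E) : ℕ → (E →ₗ.[ℂ] E)
  | 0 => LinearMap.toPMap LinearMap.id ⊤
  | k + 1 => opComp A (opPow A k)

/-- The graph norm `‖f‖ + ‖B f‖` on the domain of an unbounded operator `B`. -/
def graphNorm (B : E →ₗ.[ℂ] E) (f : B.domain) : ℝ := ‖(f : E)‖ + ‖B f‖

/-- `(T t)` for `t ≥ 0` is a strongly continuous semigroup of bounded linear operators
(the values at negative times are irrelevant). -/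
structure IsC0Semigroup (T : ℝ → E →L[ℂ] E) : Prop where
  zero : T 0 = ContinuousLinearMap.id ℂ E
  add : ∀ s t : ℝ, 0 ≤ s → 0 ≤ t → T (s + t) = T s ∘L T t
  cont : ∀ f : E, Tendsto (fun t : ℝ => T t f) (𝓝[>] 0) (𝓝 f)

/-- `A` is the infinitesimal generator of `T`: `f ∈ D(A)` and `A f = g` if and only if
`(T t f - f) / t → g` as `t → 0+`. -/
def IsGenerator (A : E →ₗ.[ℂ] E) (T : ℝ → E →L[ℂ] E) : Prop :=
  ∀ f g : E, (f, g) ∈ A.graph ↔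
    Tendsto (fun t : ℝ => ((t : ℂ)⁻¹) • (T t f - f)) (𝓝[>] 0) (𝓝 g)

/-- The open sector `{z ≠ 0 | |arg z| < δ}` in the complex plane. -/
def sector (δ : ℝ) : Set ℂ := {z : ℂ | z ≠ 0 ∧ |z.arg| < δ}

/-- `T` is a bounded analytic semigroup: for some `δ ∈ (0, π / 2]` it extends to an analytic
family `S` on the sector of angle `δ`, with the semigroup law, which on every strictly smaller
sector is bounded and converges strongly to the identity at `0`. -/
def IsBoundedAnalytic (T : ℝ → E →L[ℂ] E) : Prop :=
  ∃ δ : ℝ, 0 < δ ∧ δ ≤ Real.pi / 2 ∧ ∃ S : ℂ → E →L[ℂ] E,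
    (∀ t : ℝ, 0 < t → S (t : ℂ) = T t) ∧
    (∀ z ∈ sector δ, ∀ w ∈ sector δ, S (z + w) = S z ∘L S w) ∧
    DifferentiableOn ℂ S (sector δ) ∧
    ∀ δ' : ℝ, 0 < δ' → δ' < δ →
      (∃ M : ℝ, ∀ z ∈ sector δ', ‖S z‖ ≤ M) ∧
      ∀ f : E, Tendsto (fun z : ℂ => S z f) (𝓝[sector δ'] 0) (𝓝 f)

end Operators

section Holder

variable {X : Type*} [EMetricSpace X]

/-- The norm of the space of bounded `α`-Hölder continuous functions `X → ℂ`, namely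
`sup |u| + sup_{x ≠ x'} |u x - u x'| / d(x, x') ^ α`; a function belongs to the space exactly when
this is finite. -/
def holderENorm (α : ℝ≥0) (u : X → ℂ) : ℝ≥0∞ := (⨆ x, ‖u x‖ₑ) + eHolderNorm α u

/-- `D(B)`, with the graph norm, is continuously embedded into the space of bounded
`α`-Hölder continuous functions: there is a linear map `J` which is bounded between these spaces
and sends (the class) `f` to a representative of `f`. -/
def EmbedsInHolder [MeasurableSpace X] {μ : Measure X} {r : ℝ≥0∞} [Fact (1 ≤ r)]
    (B : Lp ℂ r μ →ₗ.[ℂ] Lp ℂ r μ) (α : ℝ≥0) : Prop :=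
  ∃ J : B.domain →ₗ[ℂ] (X → ℂ), ∃ M : ℝ≥0, ∀ f : B.domain,
    J f =ᵐ[μ] ((f : Lp ℂ r μ) : X → ℂ) ∧
    holderENorm α (J f) ≤ (M : ℝ≥0∞) * ENNReal.ofReal (graphNorm B f)

end Holder

section Dual

variable {X : Type*} [MeasurableSpace X] {μ : Measure X}
  {r : ℝ≥0∞} [Fact (1 ≤ r)] (r' : ℝ≥0∞) [Fact (1 ≤ r')] [ENNReal.HolderConjugate r r']

/-- The bilinear duality `⟨f, g⟩ = ∫ f g dμ` between `L^r` and `L^{r'}`. -/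
def pairing (f : Lp ℂ r μ) : Lp ℂ r' μ →L[ℂ] ℂ :=
  (ContinuousLinearMap.mul ℂ ℂ).lpPairing μ r r' f

theorem pairing_eq (f : Lp ℂ r μ) (g : Lp ℂ r' μ) :
    pairing r' f g = ∫ x, f x * g x ∂μ := by
  simp [pairing, ContinuousLinearMap.lpPairing_eq_integral]

/-- The graph of the adjoint: pairs `(g, h)` in `L^{r'}` with `⟨A f, g⟩ = ⟨f, h⟩` for all
`f ∈ D(A)`. -/
def dualGraph (A : Lp ℂ r μ →ₗ.[ℂ] Lp ℂ r μ) : Submodule ℂ (Lp ℂ r' μ × Lp ℂ r' μ) where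
  carrier := {p | ∀ f : A.domain, pairing r' (A f) p.1 = pairing r' (f : Lp ℂ r μ) p.2}
  add_mem' := by
    intro p q hp hq f
    simp [hp f, hq f]
  zero_mem' := by
    intro f
    simp
  smul_mem' := by
    intro c p hp f
    simp [hp f]

/-- The adjoint `A'` of `A`, as an operator on `L^{r'}`; its graph is `dualGraph r' A` as soon as
`A` is densely defined, see `dualOp_graph`. -/
def dualOp (A : Lp ℂ r μ →ₗ.[ℂ] Lp ℂ r μ) : Lp ℂ r' μ →ₗ.[ℂ] Lp ℂ r' μ :=
  (dualGraph r' A).toLinearPMap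

theorem dualOp_graph [SigmaFinite μ] (A : Lp ℂ r μ →ₗ.[ℂ] Lp ℂ r μ)
    (hA : Dense (A.domain : Set (Lp ℂ r μ))) : (dualOp r' A).graph = dualGraph r' A := by
  refine Submodule.toLinearPMap_graph_eq _ ?_
  rintro ⟨g, h⟩ hgh hg
  simp only at hg
  subst hg
  have h0 : ∀ f : Lp ℂ r μ, pairing r' f h = 0 := by
    have hc : Continuous fun f : Lp ℂ r μ => pairing r' f h :=
      (((ContinuousLinearMap.mul ℂ ℂ).lpPairing μ r r').flip h).continuous
    have := Continuous.ext_on hA hc (continuous_const (y := (0 : ℂ))) (by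
      intro f hf
      have := hgh ⟨f, hf⟩
      simpa using this.symm)
    exact fun f => congrFun this f
  have key : (h : X → ℂ) =ᵐ[μ] 0 := by
    refine ae_eq_zero_of_forall_setIntegral_eq_of_sigmaFinite ?_ ?_
    · intro s _ hμs
      have : IsFiniteMeasure (μ.restrict s) := ⟨by simpa using hμs⟩
      exact ((Lp.memLp h).restrict s).integrable (Fact.out)
    · intro s hs hμs
      have h1 := h0 (indicatorConstLp r hs hμs.ne (1 : ℂ))
      rw [pairing_eq] at h1
      rw [← integral_indicator hs, ← h1]
      refine integral_congr_ae ?_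
      filter_upwards [indicatorConstLp_coeFn (p := r) (hs := hs) (hμs := hμs.ne) (c := (1 : ℂ))]
        with x hx
      rw [hx]
      by_cases hxs : x ∈ s <;> simp [hxs]
  exact (Lp.eq_zero_iff_ae_eq_zero).2 key

end Dual

/-- `p` is the heat kernel of the semigroup `T` on `L^r`: for every `t > 0`, the operator `T t` is
an integral operator with kernel `p t`, which is measurable with respect to the completed product
measure. -/
def IsHeatKernel {X : Type*} [MeasurableSpace X] {μ : Measure X} {r : ℝ≥0∞} [Fact (1 ≤ r)]
    (T : ℝ → Lp ℂ r μ →L[ℂ] Lp ℂ r μ) (p : ℝ → X → X → ℂ) : Prop :=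
  ∀ t : ℝ, 0 < t →
    NullMeasurable (fun z : X × X => p t z.1 z.2) (μ.prod μ) ∧
    ∀ f : Lp ℂ r μ,
      (∀ᵐ x ∂μ, Integrable (fun y => p t x y * f y) μ) ∧
      T t f =ᵐ[μ] fun x => ∫ y, p t x y * f y ∂μ

end HeatKernel

end

/-!
Fix `t > 0`. A bounded analytic semigroup maps `L^r` into `D(A ^ k)`, so the embedding `J` turns
`f ↦ J (T t f) x` into a bounded functional on `L^r` for *every* point `x`. As `r < ∞` and `μ` is
σ-finite, it is the pairing with some `g x ∈ L^{r'}`, and `g x` is the section `p_t(x, ·)` of the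
kernel. For `f ∈ D(A)` the pairing of `A f` with `g x` is `J (A T t f) x`, which is again bounded in
the norm of `f`; hence `g x ∈ D(A')`. The Hölder bound for `J` gives the Hölder bound for `g` and
`A' g`, with constants governed by the norms of `A ^ j T t`, `j ≤ k + 1`, which are `O(t ^ (-j))`
by the Cauchy estimate for the derivative of the semigroup and by `A ^ j T (j s) = (A T s) ^ j`
(`exists_smoothing`, `exists_dual_evaluation`).

The duality of `L^r` and `L^{r'}` (`exists_pairing_eq`) is proved with a weight `w`: a bounded
functional evaluated on `w` times indicators is a set function which the Radon–Nikodym theorem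
represents by a density, and testing against truncations shows that the density is in `L^{r'}`.

The remaining point is joint measurability of `(x, y) ↦ p_t(x, y)`. Neither `L^r` nor `X` need be
separable, so the weak measurability of `x ↦ g x` alone does not suffice. The Radon–Nikodym
derivative `K` of `E ↦ ∫ ∫_{E_x} g x` is a jointly measurable candidate, but a priori it agrees with
`g x`, for almost every `x`, only when tested against one function at a time. The semigroup law
decides: `T t` factors through `T (t / 2)`, and the density of the latter is measurable for a
countably generated σ-algebra `Σ₀` in the second variable. Functions with vanishing conditional
expectation on `Σ₀` are therefore annihilated by `T (t / 2)`, hence by `g x` for every `x`, which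
means that every `g x` is `Σ₀`-measurable. Countably many test functions then suffice to identify
`K (x, ·)` with `g x` for almost every `x` (`exists_measurable_kernel_of_factor`); on the remaining
null set of `x` the kernel is taken to be `g x` itself.
-/

noncomputable section

namespace HeatKernel

/-! ### Densities of countably additive set functions -/

/-- Radon–Nikodym theorem for a real set function which is countably additive on measurable sets
and vanishes on null sets. -/
theorem exists_density_real {Ω : Type*} [MeasurableSpace Ω] (m : Measure Ω) [SigmaFinite m]
    (ν : Set Ω → ℝ)
    (hν : ∀ E : ℕ → Set Ω, (∀ i, MeasurableSet (E i)) → Pairwise (Function.onFun Disjoint E) →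
      HasSum (fun i => ν (E i)) (ν (⋃ i, E i)))
    (h0 : ∀ E, MeasurableSet E → m E = 0 → ν E = 0) :
    ∃ k : Ω → ℝ, Measurable k ∧ Integrable k m ∧
      ∀ E, MeasurableSet E → ν E = ∫ x in E, k x ∂m := by
  classical
  let s : SignedMeasure Ω :=
    { measureOf' := fun E => if MeasurableSet E then ν E else 0
      empty' := by simp [h0 ∅ MeasurableSet.empty (by simp)]
      not_measurable' := fun E hE => by simp [hE]
      m_iUnion' := fun E hE hd => by
        simpa [hE, MeasurableSet.iUnion hE] using hν E hE hd }
  have hs : ∀ E, MeasurableSet E → s E = ν E := fun E hE => by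
    change (if MeasurableSet E then ν E else 0) = ν E
    simp [hE]
  have hac : s ≪ᵥ m.toENNRealVectorMeasure := by
    refine VectorMeasure.AbsolutelyContinuous.mk fun E hE hmE => ?_
    rw [Measure.toENNRealVectorMeasure_apply_measurable hE] at hmE
    rw [hs E hE, h0 E hE hmE]
  refine ⟨s.rnDeriv m, s.measurable_rnDeriv m, s.integrable_rnDeriv m, fun E hE => ?_⟩
  rw [← withDensityᵥ_apply (s.integrable_rnDeriv m) hE, s.withDensityᵥ_rnDeriv_eq m hac, hs E hE]

/-- Radon–Nikodym theorem for a complex set function which is countably additive on measurable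
sets and vanishes on null sets. -/
theorem exists_density {Ω : Type*} [MeasurableSpace Ω] (m : Measure Ω) [SigmaFinite m]
    (ν : Set Ω → ℂ)
    (hν : ∀ E : ℕ → Set Ω, (∀ i, MeasurableSet (E i)) → Pairwise (Function.onFun Disjoint E) →
      HasSum (fun i => ν (E i)) (ν (⋃ i, E i)))
    (h0 : ∀ E, MeasurableSet E → m E = 0 → ν E = 0) :
    ∃ k : Ω → ℂ, Measurable k ∧ Integrable k m ∧
      ∀ E, MeasurableSet E → ν E = ∫ x in E, k x ∂m := by
  obtain ⟨a, ham, hai, ha⟩ := exists_density_real m (fun E => (ν E).re)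
    (fun E hE hd => Complex.hasSum_re (hν E hE hd)) (fun E hE h => by simp [h0 E hE h])
  obtain ⟨b, hbm, hbi, hb⟩ := exists_density_real m (fun E => (ν E).im)
    (fun E hE hd => Complex.hasSum_im (hν E hE hd)) (fun E hE h => by simp [h0 E hE h])
  have h1 : Integrable (fun x => (a x : ℂ)) m := hai.ofReal
  have h2 : Integrable (fun x => (b x : ℂ) * Complex.I) m := hbi.ofReal.mul_const _
  refine ⟨fun x => a x + b x * Complex.I, by fun_prop, h1.add h2, fun E hE => ?_⟩
  rw [integral_add h1.integrableOn h2.integrableOn, integral_mul_const, integral_complex_ofReal,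
    integral_complex_ofReal, ← ha E hE, ← hb E hE, Complex.re_add_im]

/-- A finitely additive set function `ν` with `‖ν E‖ ≤ C (m E) ^ θ` for a finite measure `m` and
some `θ > 0` has an integrable density: the bound makes it continuous at `∅`, hence countably
additive. -/
theorem exists_density_of_le_rpow {Ω : Type*} [MeasurableSpace Ω] (m : Measure Ω)
    [IsFiniteMeasure m] (ν : Set Ω → ℂ) (C θ : ℝ) (hθ : 0 < θ)
    (hadd : ∀ E F, MeasurableSet E → MeasurableSet F → Disjoint E F → ν (E ∪ F) = ν E + ν F)
    (hb : ∀ E, MeasurableSet E → ‖ν E‖ ≤ C * m.real E ^ θ) :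
    ∃ k : Ω → ℂ, Measurable k ∧ Integrable k m ∧
      ∀ E, MeasurableSet E → ν E = ∫ x in E, k x ∂m := by
  -- `0 ^ θ = 0` because `θ > 0`
  have h0 : ∀ E, MeasurableSet E → m E = 0 → ν E = 0 := fun E hE h => by
    have := hb E hE
    rw [measureReal_def, h, ENNReal.toReal_zero, Real.zero_rpow hθ.ne', mul_zero] at this
    simpa using this
  refine exists_density m ν (fun E hE hd => ?_) h0
  have hfin : ∀ s : Finset ℕ, ν (⋃ i ∈ s, E i) = ∑ i ∈ s, ν (E i) := by
    classical
    intro s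
    induction s using Finset.induction_on with
    | empty => simpa using h0 ∅ MeasurableSet.empty (by simp)
    | insert a s ha ih =>
      rw [Finset.set_biUnion_insert, hadd _ _ (hE a) (s.measurableSet_biUnion fun i _ => hE i) ?_,
        Finset.sum_insert ha, ih]
      rw [Set.disjoint_iUnion₂_right]
      intro i hi
      exact hd (fun h => ha (h ▸ hi))
  have hm : HasSum (fun i => m.real (E i)) (m.real (⋃ i, E i)) := by
    have := (measure_iUnion hd hE).symm ▸ measure_ne_top m (⋃ i, E i)
    rw [measureReal_def, measure_iUnion hd hE, ENNReal.tsum_toReal_eq fun i => measure_ne_top m _]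
    exact ENNReal.hasSum_toReal this
  have key : ∀ s : Finset ℕ, ‖∑ i ∈ s, ν (E i) - ν (⋃ i, E i)‖
      ≤ C * (m.real (⋃ i, E i) - ∑ i ∈ s, m.real (E i)) ^ θ := by
    intro s
    have hsU : MeasurableSet (⋃ i ∈ s, E i) := s.measurableSet_biUnion fun i _ => hE i
    have hU : MeasurableSet (⋃ i, E i) := MeasurableSet.iUnion hE
    have hsub : (⋃ i ∈ s, E i) ⊆ ⋃ i, E i := Set.iUnion₂_subset fun i _ => Set.subset_iUnion E i
    have h1 := hadd _ _ hsU (hU.diff hsU) Set.disjoint_sdiff_right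
    rw [Set.union_sdiff_cancel hsub, hfin] at h1
    have h2 : m.real ((⋃ i, E i) \ ⋃ i ∈ s, E i) = m.real (⋃ i, E i) - ∑ i ∈ s, m.real (E i) := by
      rw [measureReal_sdiff hsub hsU, measureReal_biUnion_finset (fun i _ j _ hij => hd hij)
        (fun i _ => hE i)]
    rw [h1, sub_add_cancel_left, norm_neg, ← h2]
    exact hb _ (hU.diff hsU)
  rw [HasSum, SummationFilter.unconditional_filter, tendsto_iff_norm_sub_tendsto_zero]
  refine squeeze_zero (fun _ => norm_nonneg _) key ?_
  have h3 : Tendsto (fun s : Finset ℕ => m.real (⋃ i, E i) - ∑ i ∈ s, m.real (E i)) atTop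
      (𝓝 0) := by
    have := (tendsto_const_nhds (x := m.real (⋃ i, E i))).sub hm
    rwa [sub_self] at this
  simpa [Real.zero_rpow hθ.ne'] using (h3.rpow_const (Or.inr hθ.le)).const_mul C

/-- A property of bounded measurable functions holds for all of them if it holds for multiples of
indicators and is stable under sums and under bounded pointwise limits. -/
theorem bounded_measurable_induction {Ω E : Type*} [MeasurableSpace Ω] [NormedAddCommGroup E]
    [NormedSpace ℝ E] [SecondCountableTopology E] [MeasurableSpace E] [BorelSpace E]
    (P : (Ω → E) → Prop)
    (indicator : ∀ c B, MeasurableSet B → P (B.indicator fun _ => c))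
    (add : ∀ f g, Measurable f → Measurable g → (∃ c, ∀ y, ‖f y‖ ≤ c) → (∃ c, ∀ y, ‖g y‖ ≤ c) →
      P f → P g → P (f + g))
    (lim : ∀ (F : ℕ → Ω → E) (f : Ω → E) (c : ℝ), (∀ k, Measurable (F k)) → Measurable f →
      (∀ k y, ‖F k y‖ ≤ c) → (∀ y, ‖f y‖ ≤ c) →
      (∀ y, Tendsto (fun k => F k y) atTop (𝓝 (f y))) → (∀ k, P (F k)) → P f)
    (f : Ω → E) (hf : Measurable f) (c : ℝ) (hc : ∀ y, ‖f y‖ ≤ c) : P f := by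
  have hsimple : ∀ φ : SimpleFunc Ω E, P φ := by
    intro φ
    induction φ using SimpleFunc.induction with
    | const a hB =>
      refine (congrArg P (funext fun y => ?_)).mp (indicator a _ hB)
      simp [Set.indicator, Set.piecewise]
    | @add φ ψ _ h1 h2 =>
      exact add φ ψ φ.measurable ψ.measurable φ.exists_forall_norm_le ψ.exists_forall_norm_le h1 h2
  have hfs := hf.stronglyMeasurable
  exact lim (fun k => hfs.approxBounded c k) f c (fun k => (hfs.approxBounded c k).measurable) hf
    (fun k y => hfs.norm_approxBounded_le ((norm_nonneg _).trans (hc y)) k y) hc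
    (fun y => hfs.tendsto_approxBounded_of_norm_le (hc y)) fun k => hsimple _

/-! ### Jointly measurable densities of families of integrable functions -/

section Kernel

variable {X Y : Type*} [MeasurableSpace X] [MeasurableSpace Y]

/-- Integrals over the sections of a measurable set of a weakly measurable family of integrable
functions are measurable. -/
theorem aestronglyMeasurable_integral_section (m : Measure X) (n : Measure Y)
    (g : X → Y → ℂ) (hg : ∀ x, Integrable (g x) n)
    (hm : ∀ B, MeasurableSet B → AEStronglyMeasurable (fun x => ∫ y in B, g x y ∂n) m)
    (E : Set (X × Y)) (hE : MeasurableSet E) :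
    AEStronglyMeasurable (fun x => ∫ y in Prod.mk x ⁻¹' E, g x y ∂n) m := by
  induction E, hE using
    MeasurableSpace.induction_on_inter generateFrom_prod.symm isPiSystem_prod with
  | empty => simpa using aestronglyMeasurable_const
  | basic E hE =>
    obtain ⟨A, hA, B, hB, rfl⟩ := hE
    refine ((hm B hB).indicator hA).congr (Eventually.of_forall fun x => ?_)
    by_cases hx : x ∈ A <;> simp [hx]
  | compl E hE ih =>
    refine ((hm _ MeasurableSet.univ).sub ih).congr (Eventually.of_forall fun x => ?_)
    have := integral_add_compl (measurable_prodMk_left hE : MeasurableSet (Prod.mk x ⁻¹' E)) (hg x)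
    simp only [Pi.sub_apply, Measure.restrict_univ, Set.preimage_compl]
    rw [← this, add_sub_cancel_left]
  | iUnion E hd hE ih =>
    have hs : ∀ x, HasSum (fun i => ∫ y in Prod.mk x ⁻¹' E i, g x y ∂n)
        (∫ y in Prod.mk x ⁻¹' ⋃ i, E i, g x y ∂n) := fun x => by
      rw [Set.preimage_iUnion]
      exact hasSum_integral_iUnion (fun i => measurable_prodMk_left (hE i))
        (fun i j hij => (hd hij).preimage _) (hg x).integrableOn
    exact aestronglyMeasurable_of_tendsto_ae atTop
      (fun N => Finset.aestronglyMeasurable_fun_sum (Finset.range N) fun i _ => ih i)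
      (Eventually.of_forall fun x => (hs x).tendsto_sum_nat)

/-- A bounded, weakly measurable family of integrable functions `g x` has a jointly measurable
density `K`: it is the Radon–Nikodym derivative of `E ↦ ∫ ∫_{E_x} g x y dn(y) dm(x)`. The
exceptional set in the conclusion depends on `B`. -/
theorem exists_measurable_kernel (m : Measure X) (n : Measure Y) [IsFiniteMeasure m]
    [IsFiniteMeasure n] (g : X → Y → ℂ) (C : ℝ) (hg : ∀ x, Integrable (g x) n)
    (hC : ∀ x, ∫ y, ‖g x y‖ ∂n ≤ C)
    (hm : ∀ B, MeasurableSet B → AEStronglyMeasurable (fun x => ∫ y in B, g x y ∂n) m) :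
    ∃ K : X × Y → ℂ, Measurable K ∧ Integrable K (m.prod n) ∧
      ∀ B, MeasurableSet B → ∀ᵐ x ∂m, ∫ y in B, K (x, y) ∂n = ∫ y in B, g x y ∂n := by
  set q : Set (X × Y) → X → ℂ := fun E x => ∫ y in Prod.mk x ⁻¹' E, g x y ∂n with hq
  have hle : ∀ E x, ‖q E x‖ ≤ ∫ y in Prod.mk x ⁻¹' E, ‖g x y‖ ∂n :=
    fun E x => norm_integral_le_integral_norm _
  have hleC : ∀ E x, ∫ y in Prod.mk x ⁻¹' E, ‖g x y‖ ∂n ≤ C := fun E x =>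
    (setIntegral_le_integral (hg x).norm (Eventually.of_forall fun _ => norm_nonneg _)).trans (hC x)
  have hqi : ∀ E, MeasurableSet E → Integrable (q E) m := fun E hE =>
    Integrable.of_bound (aestronglyMeasurable_integral_section m n g hg hm E hE) C
      (Eventually.of_forall fun x => (hle E x).trans (hleC E x))
  obtain ⟨K, hKm, hKi, hK⟩ := exists_density (m.prod n) (fun E => ∫ x, q E x ∂m) (by
    intro E hE hd
    have hsum : ∀ x, HasSum (fun i => q (E i) x) (q (⋃ i, E i) x) := fun x => by
      simp only [hq, Set.preimage_iUnion]
      exact hasSum_integral_iUnion (fun i => measurable_prodMk_left (hE i))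
        (fun i j hij => (hd hij).preimage _) (hg x).integrableOn
    have h1 : Summable fun i => ∫ x, ‖q (E i) x‖ ∂m := by
      refine summable_of_sum_le (c := ∫ _, C ∂m)
        (fun i => integral_nonneg fun _ => norm_nonneg _) fun s => ?_
      rw [← integral_finsetSum _ fun i _ => (hqi (E i) (hE i)).norm]
      refine integral_mono (integrable_finsetSum _ fun i _ => (hqi (E i) (hE i)).norm)
        (integrable_const _) fun x => ?_
      refine (Finset.sum_le_sum fun i _ => hle (E i) x).trans ?_
      rw [← integral_biUnion_finset s (fun i _ => measurable_prodMk_left (hE i))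
        (fun i _ j _ hij => (hd hij).preimage _) fun i _ => (hg x).norm.integrableOn]
      exact (setIntegral_le_integral (hg x).norm
        (Eventually.of_forall fun _ => norm_nonneg _)).trans (hC x)
    have h2 := hasSum_integral_of_summable_integral_norm (fun i => hqi (E i) (hE i)) h1
    simpa only [(hsum _).tsum_eq] using h2) (by
    intro E hE h0
    refine integral_eq_zero_of_ae ?_
    filter_upwards [Measure.measure_ae_null_of_prod_null h0] with x hx
    simp only [hq, Pi.zero_apply]
    exact setIntegral_measure_zero _ hx)
  refine ⟨K, hKm, hKi, fun B hB => ?_⟩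
  refine Integrable.ae_eq_of_forall_setIntegral_eq _ _ ?_ ?_ fun A hA _ => ?_
  · have : Integrable K (m.prod (n.restrict B)) := by
      refine hKi.mono_measure ?_
      exact Measure.prod_mono le_rfl Measure.restrict_le_self
    exact this.integral_prod_left
  · simpa [hq] using hqi (Set.univ ×ˢ B) (MeasurableSet.univ.prod hB)
  · rw [← setIntegral_prod _ hKi.integrableOn, ← hK _ (hA.prod hB), ← integral_indicator hA]
    refine integral_congr_ae (Eventually.of_forall fun x => ?_)
    by_cases hx : x ∈ A <;> simp [hq, hx]

/-- If the integrals of `d x` over each measurable set vanish for almost every `x`, then so do the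
integrals against each bounded measurable function. -/
theorem ae_integral_smul_eq_zero (m : Measure X) (n : Measure Y) (d : X → Y → ℂ)
    (hd : ∀ᵐ x ∂m, Integrable (d x) n)
    (h0 : ∀ B, MeasurableSet B → ∀ᵐ x ∂m, ∫ y in B, d x y ∂n = 0)
    (f : Y → ℝ) (hf : Measurable f) (c : ℝ) (hc : ∀ y, |f y| ≤ c) :
    ∀ᵐ x ∂m, ∫ y, f y • d x y ∂n = 0 := by
  refine bounded_measurable_induction (fun f => ∀ᵐ x ∂m, ∫ y, f y • d x y ∂n = 0)
    (fun a B hB => ?_) (fun f g hf hg hbf hbg h1 h2 => ?_)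
    (fun F f c hF hf hFc _ hlim hP => ?_) f hf c hc
  · filter_upwards [h0 B hB] with x hx
    have : ∀ y, B.indicator (fun _ => a) y • d x y = B.indicator (fun y => a • d x y) y :=
      fun y => by by_cases hy : y ∈ B <;> simp [hy]
    simp_rw [this]
    rw [integral_indicator hB, integral_smul, hx, smul_zero]
  · obtain ⟨b, hb⟩ := hbf
    obtain ⟨b', hb'⟩ := hbg
    filter_upwards [h1, h2, hd] with x h1 h2 hd
    simp only [Pi.add_apply, add_smul]
    have hi : ∀ (φ : Y → ℝ) (b : ℝ), Measurable φ → (∀ y, ‖φ y‖ ≤ b) →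
        Integrable (fun y => φ y • d x y) n := fun φ b hφ hb =>
      hd.bdd_smul b hφ.aestronglyMeasurable (Eventually.of_forall hb)
    rw [integral_add (hi f b hf hb) (hi g b' hg hb'), h1, h2, add_zero]
  · filter_upwards [ae_all_iff.2 hP, hd] with x hx hdx
    suffices ht : Tendsto (fun k => ∫ y, F k y • d x y ∂n) atTop (𝓝 (∫ y, f y • d x y ∂n)) by
      simp only [hx] at ht
      exact tendsto_nhds_unique ht tendsto_const_nhds
    refine tendsto_integral_of_dominated_convergence (fun y => c * ‖d x y‖)
      (fun k => (hF k).aestronglyMeasurable.smul hdx.aestronglyMeasurable) (hdx.norm.const_mul c)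
      (fun k => Eventually.of_forall fun y => ?_)
      (Eventually.of_forall fun y => (hlim y).smul_const _)
    rw [norm_smul]
    gcongr
    exact hFc k y

/-- A measurable set of a product is measurable for a countably generated σ-algebra on the second
factor. -/
theorem exists_countable_measurableSet_prod (E : Set (X × Y)) (hE : MeasurableSet E) :
    ∃ S : Set (Set Y), S.Countable ∧ (∀ B ∈ S, MeasurableSet B) ∧
      ∀ S' : Set (Set Y), S ⊆ S' →
        MeasurableSet[@Prod.instMeasurableSpace X Y _ (MeasurableSpace.generateFrom S')] E := by
  induction E, hE using
    MeasurableSpace.induction_on_inter generateFrom_prod.symm isPiSystem_prod with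
  | empty => exact ⟨∅, Set.countable_empty, by simp, fun _ _ => @MeasurableSet.empty _ (_)⟩
  | basic E hE =>
    obtain ⟨A, hA, B, hB, rfl⟩ := hE
    refine ⟨{B}, Set.countable_singleton _, by simpa using hB, fun S' hS' => ?_⟩
    exact @MeasurableSet.prod X Y _ (_) A B hA
      (MeasurableSpace.measurableSet_generateFrom (hS' rfl))
  | compl E hE ih =>
    obtain ⟨S, hS, hm, h⟩ := ih
    exact ⟨S, hS, hm, fun S' hS' => @MeasurableSet.compl _ E (_) (h S' hS')⟩
  | iUnion E hd hE ih =>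
    choose S hS hm h using ih
    refine ⟨⋃ i, S i, Set.countable_iUnion hS, fun B hB => ?_, fun S' hS' => ?_⟩
    · obtain ⟨i, hi⟩ := Set.mem_iUnion.1 hB
      exact hm i B hi
    · exact @MeasurableSet.iUnion _ ℕ (_) _ E fun i =>
        h i S' ((Set.subset_iUnion S i).trans hS')

/-- A measurable function on a product with values in a countably generated space is measurable
for a countably generated σ-algebra on the second factor. -/
theorem exists_countable_measurable_prod {β : Type*} [MeasurableSpace β]
    [MeasurableSpace.CountablyGenerated β] (K : X × Y → β) (hK : Measurable K) :
    ∃ S : Set (Set Y), S.Countable ∧ (∀ B ∈ S, MeasurableSet B) ∧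
      @Measurable _ _ (@Prod.instMeasurableSpace X Y _ (MeasurableSpace.generateFrom S)) _ K := by
  have := fun s : MeasurableSpace.countableGeneratingSet β =>
    exists_countable_measurableSet_prod (K ⁻¹' s)
      (hK (MeasurableSpace.measurableSet_countableGeneratingSet s.2))
  choose S hS hm h using this
  have hcount : Countable (MeasurableSpace.countableGeneratingSet β) :=
    (MeasurableSpace.countable_countableGeneratingSet (α := β)).to_subtype
  refine ⟨⋃ s, S s, Set.countable_iUnion hS, fun B hB => ?_, ?_⟩
  · obtain ⟨i, hi⟩ := Set.mem_iUnion.1 hB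
    exact hm i B hi
  · have h1 := @measurable_generateFrom _ _ (@Prod.instMeasurableSpace X Y _
      (MeasurableSpace.generateFrom (⋃ s, S s))) (MeasurableSpace.countableGeneratingSet β) K
      fun s hs => h ⟨s, hs⟩ _ (Set.subset_iUnion S ⟨s, hs⟩)
    rwa [MeasurableSpace.generateFrom_countableGeneratingSet] at h1

end Kernel

/-! ### Families that factor through a family with a density -/

section Conditional

variable {Y : Type*} {m m₀ : MeasurableSpace Y}

/-- Pull-out property of the conditional expectation in integrated form. -/
theorem integral_smul_eq_integral_condExp_smul (hm : m ≤ m₀)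
    (n : Measure Y) [IsFiniteMeasure n] (f : Y → ℝ) (hf : Measurable f) (c : ℝ)
    (hc : ∀ y, |f y| ≤ c) (k : Y → ℂ) (hk : Integrable k n) (hkm : StronglyMeasurable[m] k) :
    ∫ y, f y • k y ∂n = ∫ y, (n[f|m]) y • k y ∂n := by
  rw [← integral_condExp hm]
  exact integral_congr_ae (condExp_bilin_of_stronglyMeasurable_right
    (ContinuousLinearMap.lsmul ℝ ℝ) hkm
    (hk.bdd_smul c hf.aestronglyMeasurable (Eventually.of_forall hc))
    (Integrable.of_bound hf.aestronglyMeasurable c (Eventually.of_forall hc)))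

/-- A bounded version of the conditional probability of a set. -/
theorem exists_bounded_condExp_indicator (m : MeasurableSpace Y) {m₀ : MeasurableSpace Y}
    (n : Measure Y) [IsFiniteMeasure n] (B : Set Y) :
    ∃ c : Y → ℝ, Measurable[m] c ∧ (∀ y, |c y| ≤ 1) ∧
      c =ᵐ[n] n[B.indicator (fun _ => (1 : ℝ))|m] := by
  have hb : ∀ᵐ y ∂n, |(n[B.indicator (fun _ => (1 : ℝ))|m]) y| ≤ 1 :=
    ae_bdd_abs_condExp_of_ae_bdd_abs (Eventually.of_forall fun y => by
      by_cases hy : y ∈ B <;> simp [hy])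
  refine ⟨fun y => max (-1) (min 1 ((n[B.indicator (fun _ => (1 : ℝ))|m]) y)), ?_, fun y => ?_, ?_⟩
  · exact measurable_const.max (measurable_const.min stronglyMeasurable_condExp.measurable)
  · rw [abs_le]
    exact ⟨le_max_left _ _, max_le (by norm_num) (min_le_left _ _)⟩
  · filter_upwards [hb] with y hy
    rw [abs_le] at hy
    rw [min_eq_right hy.2, max_eq_right hy.1]

/-- A function orthogonal to every bounded function whose conditional expectation vanishes is
itself a conditional expectation. -/
theorem ae_eq_condExp_of_annihilates (hm : m ≤ m₀)
    (n : Measure Y) [IsFiniteMeasure n] (k : Y → ℂ) (hk : Integrable k n)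
    (h : ∀ f : Y → ℝ, Measurable f → (∃ c, ∀ y, |f y| ≤ c) → n[f|m] =ᵐ[n] 0 →
      ∫ y, f y • k y ∂n = 0) :
    k =ᵐ[n] n[k|m] := by
  refine Integrable.ae_eq_of_forall_setIntegral_eq _ _ hk integrable_condExp fun B hB _ => ?_
  obtain ⟨c, hcm, hc1, hc⟩ := exists_bounded_condExp_indicator m n B
  have hcm' : Measurable c := hcm.mono hm le_rfl
  have hci : Integrable c n :=
    Integrable.of_bound hcm'.aestronglyMeasurable 1 (Eventually.of_forall hc1)
  set χ : Y → ℝ := B.indicator fun _ => (1 : ℝ) with hχ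
  have hχm : Measurable χ := measurable_const.indicator hB
  have hχ1 : ∀ y, |χ y| ≤ 1 := fun y => by by_cases hy : y ∈ B <;> simp [hχ, hy]
  have hχi : Integrable χ n :=
    Integrable.of_bound hχm.aestronglyMeasurable 1 (Eventually.of_forall hχ1)
  have hset : ∀ u : Y → ℂ, ∫ y in B, u y ∂n = ∫ y, χ y • u y ∂n := fun u => by
    rw [← integral_indicator hB]
    refine integral_congr_ae (Eventually.of_forall fun y => ?_)
    by_cases hy : y ∈ B <;> simp [hχ, hy]
  have h1 : ∫ y, (χ - c) y • k y ∂n = 0 := by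
    refine h _ (hχm.sub hcm') ⟨2, fun y => ?_⟩ ?_
    · exact (abs_sub _ _).trans (by linarith [hχ1 y, hc1 y])
    · filter_upwards [condExp_sub hχi hci m, hc] with y hy hcy
      rw [hy, Pi.sub_apply, condExp_of_stronglyMeasurable hm hcm.stronglyMeasurable hci, hcy]
      simp
  have hbs : ∀ (f : Y → ℝ) (u : Y → ℂ), Measurable f → (∀ y, |f y| ≤ 1) → Integrable u n →
      Integrable (fun y => f y • u y) n := fun f u hf hf1 hu =>
    hu.bdd_smul 1 hf.aestronglyMeasurable (Eventually.of_forall hf1)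
  have h2 : ∫ y, χ y • k y ∂n = ∫ y, c y • k y ∂n := by
    rw [← sub_eq_zero, ← integral_sub (hbs _ _ hχm hχ1 hk) (hbs _ _ hcm' hc1 hk), ← h1]
    simp [sub_smul]
  have h3 : ∫ y, c y • k y ∂n = ∫ y, c y • (n[k|m]) y ∂n := by
    rw [← integral_condExp hm]
    exact integral_congr_ae (condExp_bilin_of_stronglyMeasurable_left
      (ContinuousLinearMap.lsmul ℝ ℝ) hcm.stronglyMeasurable (hbs _ _ hcm' hc1 hk) hk)
  rw [hset, hset, h2, h3, integral_smul_eq_integral_condExp_smul hm n χ hχm 1 hχ1 _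
    integrable_condExp stronglyMeasurable_condExp]
  refine integral_congr_ae ?_
  filter_upwards [hc] with y hy
  rw [hy]

/-- A function measurable for the σ-algebra generated by a set algebra vanishes almost everywhere
as soon as its integrals over the sets of that algebra vanish. -/
theorem ae_eq_zero_of_setIntegral_setAlgebra (S : Set (Set Y)) (hS : IsSetAlgebra S)
    (hSm : MeasurableSpace.generateFrom S ≤ m₀) (n : Measure Y) [IsFiniteMeasure n] (d : Y → ℂ)
    (hd : Integrable d n) (hdm : StronglyMeasurable[MeasurableSpace.generateFrom S] d)
    (h : ∀ B ∈ S, ∫ y in B, d y ∂n = 0) : d =ᵐ[n] 0 := by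
  have hall : ∀ B, MeasurableSet[MeasurableSpace.generateFrom S] B → ∫ y in B, d y ∂n = 0 := by
    intro B hB
    induction B, hB using
        MeasurableSpace.induction_on_inter rfl hS.isSetRing.isSetSemiring.isPiSystem with
    | empty => simp
    | basic B hB => exact h B hB
    | compl B hB ih =>
      have h1 := integral_add_compl (hSm _ hB) hd
      have h2 := h _ hS.univ_mem
      rw [Measure.restrict_univ] at h2
      rwa [ih, zero_add, h2] at h1
    | iUnion B hdis hB ih =>
      rw [integral_iUnion (fun i => hSm _ (hB i)) hdis hd.integrableOn]
      simp [ih]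
  refine ae_eq_of_forall_setIntegral_eq_of_sigmaFinite' hSm (fun B _ _ => hd.integrableOn)
    (fun B _ _ => integrable_zero _ _ _ |>.integrableOn) (fun B hB _ => ?_)
    hdm.aestronglyMeasurable (@aestronglyMeasurable_zero _ _ _ _ _ _ _)
  simpa using hall B hB

end Conditional

section Kernel

variable {X Y : Type*} [MeasurableSpace X] [m₀ : MeasurableSpace Y]

/-- Let `g` and `g'` be bounded, weakly measurable families of integrable functions such that `g'`
factors through `g`: a bounded function orthogonal to almost all `g z` is orthogonal to all `g' x`.
Then `g'` has a jointly measurable version, without any separability assumption. The densities of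
`g` and `g'` are measurable for some countably generated σ-algebra on the second factor, the
factorization forces every `g' x` to be measurable for that σ-algebra, and a countable set algebra
is then enough to compare `g' x` with its density. -/
theorem exists_measurable_kernel_of_factor (m : Measure X) (n : Measure Y) [IsFiniteMeasure m]
    [IsFiniteMeasure n] (g g' : X → Y → ℂ) (C : ℝ)
    (hg : ∀ x, Integrable (g x) n) (hC : ∀ x, ∫ y, ‖g x y‖ ∂n ≤ C)
    (hm : ∀ B, MeasurableSet B → AEStronglyMeasurable (fun x => ∫ y in B, g x y ∂n) m)
    (hg' : ∀ x, Integrable (g' x) n) (hC' : ∀ x, ∫ y, ‖g' x y‖ ∂n ≤ C)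
    (hm' : ∀ B, MeasurableSet B → AEStronglyMeasurable (fun x => ∫ y in B, g' x y ∂n) m)
    (hfac : ∀ f : Y → ℝ, Measurable f → (∃ c, ∀ y, |f y| ≤ c) →
      (∀ᵐ z ∂m, ∫ y, f y • g z y ∂n = 0) → ∀ x, ∫ y, f y • g' x y ∂n = 0) :
    ∃ K : X × Y → ℂ, Measurable K ∧ ∀ᵐ x ∂m, (fun y => K (x, y)) =ᵐ[n] g' x := by
  obtain ⟨K, hKm, hKi, hK⟩ := exists_measurable_kernel m n g C hg hC hm
  obtain ⟨K', hKm', hKi', hK'⟩ := exists_measurable_kernel m n g' C hg' hC' hm'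
  obtain ⟨S₀, hS₀, hS₀m, hS₀K⟩ := exists_countable_measurable_prod (fun z => (K z, K' z))
    (hKm.prodMk hKm')
  set S := generateSetAlgebra S₀ with hS
  rw [← generateFrom_generateSetAlgebra_eq, ← hS] at hS₀K
  have hle : MeasurableSpace.generateFrom S ≤ m₀ := by
    rw [hS, generateFrom_generateSetAlgebra_eq]
    exact MeasurableSpace.generateFrom_le hS₀m
  have hsec : ∀ x, StronglyMeasurable[MeasurableSpace.generateFrom S] (fun y => K (x, y)) ∧
      StronglyMeasurable[MeasurableSpace.generateFrom S] (fun y => K' (x, y)) := fun x => by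
    have h1 := hS₀K.comp (@measurable_prodMk_left X Y _ (MeasurableSpace.generateFrom S) x)
    exact ⟨h1.fst.stronglyMeasurable, h1.snd.stronglyMeasurable⟩
  -- every `g' x` is measurable for `generateFrom S`, because a function with vanishing conditional
  -- expectation is orthogonal to the sections of `K`, hence to almost all `g z`
  have hcond : ∀ x, g' x =ᵐ[n] n[g' x|MeasurableSpace.generateFrom S] := fun x => by
    refine ae_eq_condExp_of_annihilates hle n (g' x) (hg' x) fun f hf ⟨c, hc⟩ hf0 => ?_
    refine hfac f hf ⟨c, hc⟩ ?_ x
    have h1 := ae_integral_smul_eq_zero m n (fun z y => K (z, y) - g z y)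
      (hKi.prod_right_ae.mono fun z hz => hz.sub (hg z)) (fun B hB => by
        filter_upwards [hK B hB, hKi.prod_right_ae] with z hz hzi
        rw [integral_sub hzi.integrableOn (hg z).integrableOn, hz, sub_self]) f hf c hc
    filter_upwards [h1, hKi.prod_right_ae] with z hz hzi
    have h2 : ∫ y, f y • K (z, y) ∂n = 0 := by
      rw [integral_smul_eq_integral_condExp_smul hle n f hf c hc _ hzi (hsec z).1]
      refine integral_eq_zero_of_ae ?_
      filter_upwards [hf0] with y hy
      simp [hy]
    have hbs : ∀ u : Y → ℂ, Integrable u n → Integrable (fun y => f y • u y) n := fun u hu =>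
      hu.bdd_smul c hf.aestronglyMeasurable (Eventually.of_forall hc)
    simp only [smul_sub] at hz
    rwa [integral_sub (hbs _ hzi) (hbs _ (hg z)), h2, zero_sub, neg_eq_zero] at hz
  refine ⟨K', hKm', ?_⟩
  have hcount : S.Countable := countable_generateSetAlgebra hS₀
  have hall : ∀ᵐ x ∂m, ∀ B ∈ S, ∫ y in B, K' (x, y) ∂n = ∫ y in B, g' x y ∂n :=
    (ae_ball_iff hcount).2 fun B hB =>
      hK' B (hle _ (MeasurableSpace.measurableSet_generateFrom hB))
  filter_upwards [hall, hKi'.prod_right_ae] with x hx hxi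
  have h3 := ae_eq_zero_of_setIntegral_setAlgebra S isSetAlgebra_generateSetAlgebra hle n
    ((fun y => K' (x, y)) - n[g' x|MeasurableSpace.generateFrom S])
    (hxi.sub integrable_condExp) ((hsec x).2.sub stronglyMeasurable_condExp) (fun B hB => by
      simp only [Pi.sub_apply]
      rw [integral_sub hxi.integrableOn integrable_condExp.integrableOn, hx B hB, sub_eq_zero]
      exact integral_congr_ae (ae_restrict_of_ae (hcond x)))
  filter_upwards [h3, hcond x] with y hy hy'
  rw [hy']
  exact sub_eq_zero.1 hy

end Kernel

/-! ### Weights and dominated convergence in `L^r` -/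

section Weight

variable {X : Type*} [MeasurableSpace X] {μ : Measure X}

/-- A strictly positive integrable function bounded by `1`. Multiplication by `w` maps bounded
functions into every `L^r`, and `w μ` is a finite measure with the same null sets as `μ`. -/
structure IsWeight (μ : Measure X) (w : X → ℝ≥0) : Prop where
  measurable : Measurable w
  pos : ∀ x, 0 < w x
  le_one : ∀ x, w x ≤ 1
  lintegral_ne_top : ∫⁻ x, w x ∂μ ≠ ∞

theorem exists_isWeight (μ : Measure X) [SigmaFinite μ] : ∃ w, IsWeight μ w := by
  obtain ⟨g, hpos, hm, hi⟩ := exists_pos_lintegral_lt_of_sigmaFinite μ one_ne_zero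
  refine ⟨fun x => min (g x) 1, hm.min measurable_const, fun x => lt_min (hpos x) one_pos,
    fun x => min_le_right _ _, ne_top_of_le_ne_top (hi.trans ENNReal.one_lt_top).ne ?_⟩
  exact lintegral_mono fun x => ENNReal.coe_le_coe.2 (min_le_left _ _)

/-- The finite measure `w μ`. -/
def weighted (μ : Measure X) (w : X → ℝ≥0) : Measure X := μ.withDensity fun x => (w x : ℝ≥0∞)

namespace IsWeight

variable {w : X → ℝ≥0}

theorem isFiniteMeasure (hw : IsWeight μ w) : IsFiniteMeasure (weighted μ w) :=
  isFiniteMeasure_withDensity hw.lintegral_ne_top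

theorem ae_weighted_iff (hw : IsWeight μ w) {p : X → Prop} :
    (∀ᵐ x ∂weighted μ w, p x) ↔ ∀ᵐ x ∂μ, p x := by
  rw [weighted, ae_withDensity_iff hw.measurable.coe_nnreal_ennreal]
  exact eventually_congr (Eventually.of_forall fun x => by simp [(hw.pos x).ne'])

theorem weighted_absolutelyContinuous (μ : Measure X) (w : X → ℝ≥0) : weighted μ w ≪ μ :=
  withDensity_absolutelyContinuous _ _

theorem integral_weighted (hw : IsWeight μ w) (f : X → ℂ) :
    ∫ x, f x ∂weighted μ w = ∫ x, (w x : ℂ) * f x ∂μ := by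
  rw [weighted, integral_withDensity_eq_integral_smul hw.measurable]
  simp [NNReal.smul_def]

theorem integrable_weighted_iff (hw : IsWeight μ w) (f : X → ℂ) :
    Integrable f (weighted μ w) ↔ Integrable (fun x => (w x : ℂ) * f x) μ := by
  rw [weighted, integrable_withDensity_iff_integrable_smul hw.measurable]
  simp [NNReal.smul_def]

theorem eLpNorm_indicator_le (hw : IsWeight μ w) {r : ℝ≥0∞} (hr1 : 1 ≤ r) (hr : r ≠ ∞) {E : Set X}
    (hE : MeasurableSet E) :
    eLpNorm (fun x => (w x : ℂ) * E.indicator (fun _ => 1) x) r μ ≤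
      weighted μ w E ^ (1 / r.toReal) := by
  have hr0 : r ≠ 0 := (zero_lt_one.trans_le hr1).ne'
  have h1 : 1 ≤ r.toReal := by simpa using ENNReal.toReal_mono hr hr1
  rw [eLpNorm_eq_lintegral_rpow_enorm_toReal hr0 hr, weighted, withDensity_apply _ hE,
    ← lintegral_indicator hE]
  gcongr with x
  by_cases hx : x ∈ E
  · simp only [hx, Set.indicator_of_mem, mul_one]
    have : ‖(w x : ℂ)‖ₑ = w x := by
      rw [← ofReal_norm]; simp
    rw [this]
    exact (ENNReal.rpow_le_rpow_of_exponent_ge (by simpa using hw.le_one x) h1).trans_eq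
      (ENNReal.rpow_one _)
  · have : 0 < r.toReal := by linarith
    simp [hx, this]

theorem memLp_mul (hw : IsWeight μ w) {r : ℝ≥0∞} (hr1 : 1 ≤ r) (hr : r ≠ ∞) {f : X → ℂ}
    (hf : Measurable f) {c : ℝ} (hc : ∀ x, ‖f x‖ ≤ c) : MemLp (fun x => (w x : ℂ) * f x) r μ := by
  have hfin := hw.isFiniteMeasure
  have hm := hw.measurable
  have h1 : MemLp (fun x => (w x : ℂ) * Set.univ.indicator (fun _ => 1) x) r μ :=
    ⟨(by simp; fun_prop), (hw.eLpNorm_indicator_le hr1 hr MeasurableSet.univ).trans_lt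
      (ENNReal.rpow_lt_top_of_nonneg (by positivity) (measure_ne_top _ _))⟩
  refine h1.of_le_mul (c := c) (by fun_prop) (Eventually.of_forall fun x => ?_)
  simp only [norm_mul, Set.indicator_univ, mul_one]
  rw [mul_comm]
  gcongr
  exact hc x

end IsWeight

end Weight

section Limits

variable {X : Type*} [MeasurableSpace X] {μ : Measure X} {r : ℝ≥0∞} [Fact (1 ≤ r)]

/-- Dominated convergence in `L^r` for `r < ∞`. -/
theorem tendsto_toLp_of_dominated (hr : r ≠ ∞) (F : ℕ → X → ℂ) (f b : X → ℂ)
    (hF : ∀ k, MemLp (F k) r μ) (hf : MemLp f r μ) (hb : MemLp b r μ)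
    (hFb : ∀ k x, ‖F k x‖ ≤ ‖b x‖) (hfb : ∀ x, ‖f x‖ ≤ ‖b x‖)
    (hlim : ∀ x, Tendsto (fun k => F k x) atTop (𝓝 (f x))) :
    Tendsto (fun k => (hF k).toLp (F k)) atTop (𝓝 (hf.toLp f)) := by
  have hr1 : 1 ≤ r := Fact.out
  have hr0 : r ≠ 0 := (zero_lt_one.trans_le hr1).ne'
  have hp : 0 < r.toReal := ENNReal.toReal_pos hr0 hr
  rw [Lp.tendsto_Lp_iff_tendsto_eLpNorm'']
  have h1 : Tendsto (fun k => ∫⁻ x, ‖(F k - f) x‖ₑ ^ r.toReal ∂μ) atTop (𝓝 (∫⁻ _, 0 ∂μ)) := by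
    refine tendsto_lintegral_of_dominated_convergence' (fun x => ‖(2 * b x : ℂ)‖ₑ ^ r.toReal)
      (fun k => ((hF k).1.sub hf.1).enorm.pow_const _) (fun k => Eventually.of_forall fun x => ?_)
      ?_ (Eventually.of_forall fun x => ?_)
    · simp only
      gcongr
      rw [enorm_le_iff_norm_le, Pi.sub_apply, norm_mul, RCLike.norm_ofNat]
      exact (norm_sub_le _ _).trans (by linarith [hFb k x, hfb x])
    · exact ((lintegral_rpow_enorm_lt_top_of_eLpNorm_lt_top hr0 hr (hb.const_mul 2).2)).ne
    · have h2 : Tendsto (fun k => ‖(F k - f) x‖ₑ) atTop (𝓝 0) := by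
        have := ((hlim x).sub_const (f x)).enorm
        simpa using this
      have := (ENNReal.continuous_rpow_const (y := r.toReal)).tendsto 0 |>.comp h2
      simpa [Function.comp_def, hp] using this
  have h3 := (ENNReal.continuous_rpow_const (y := 1 / r.toReal)).tendsto _ |>.comp h1
  simp only [eLpNorm_eq_lintegral_rpow_enorm_toReal hr0 hr]
  simpa [Function.comp_def, hp] using h3

end Limits

/-! ### Functionals on `L^r` and weighted bounded functions -/

section Duality

variable {X : Type*} [MeasurableSpace X] {μ : Measure X} {w : X → ℝ≥0} {r : ℝ≥0∞} [Fact (1 ≤ r)]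

/-- A functional on `L^r` which on weighted indicators is integration against `k` is integration
against `k` on weighted bounded functions. -/
theorem IsWeight.apply_eq_integral (hw : IsWeight μ w) (hr : r ≠ ∞) (Φ : Lp ℂ r μ →L[ℂ] ℂ)
    (k : X → ℂ) (hk : Integrable k (weighted μ w))
    (h : ∀ E, MeasurableSet E → ∀ h : MemLp (fun x => (w x : ℂ) * E.indicator (fun _ => 1) x) r μ,
      Φ (h.toLp _) = ∫ x in E, k x ∂weighted μ w)
    (f : X → ℂ) (hf : Measurable f) (c : ℝ) (hc : ∀ x, ‖f x‖ ≤ c)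
    (hwf : MemLp (fun x => (w x : ℂ) * f x) r μ) :
    Φ (hwf.toLp _) = ∫ x, f x * k x ∂weighted μ w := by
  have hr1 : 1 ≤ r := Fact.out
  revert hwf
  refine bounded_measurable_induction (fun f => ∀ hwf : MemLp (fun x => (w x : ℂ) * f x) r μ,
    Φ (hwf.toLp _) = ∫ x, f x * k x ∂weighted μ w) (fun a E hE hwf => ?_)
    (fun f g hf hg hbf hbg h1 h2 hwf => ?_) (fun F f c hF hf hFc hfc hlim hP hwf => ?_) f hf c hc
  · have hi := hw.memLp_mul (μ := μ) hr1 hr (f := E.indicator fun _ => 1)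
      (measurable_const.indicator hE) (c := 1) (fun x => by by_cases hx : x ∈ E <;> simp [hx])
    have h1 : hwf.toLp _ = a • hi.toLp _ := by
      rw [← MemLp.toLp_const_smul]
      refine MemLp.toLp_congr _ _ (Eventually.of_forall fun x => ?_)
      by_cases hx : x ∈ E <;> simp [hx, mul_comm]
    rw [h1, map_smul, h E hE hi, ← integral_indicator hE, smul_eq_mul, ← integral_const_mul]
    refine integral_congr_ae (Eventually.of_forall fun x => ?_)
    by_cases hx : x ∈ E <;> simp [hx]
  · obtain ⟨b, hb⟩ := hbf
    obtain ⟨b', hb'⟩ := hbg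
    have hf' := hw.memLp_mul (μ := μ) hr1 hr hf hb
    have hg' := hw.memLp_mul (μ := μ) hr1 hr hg hb'
    have h3 : hwf.toLp _ = hf'.toLp _ + hg'.toLp _ := by
      rw [← MemLp.toLp_add]
      exact MemLp.toLp_congr _ _ (Eventually.of_forall fun x => by simp [mul_add])
    rw [h3, map_add, h1, h2, ← integral_add
      (hk.bdd_mul hf.aestronglyMeasurable (Eventually.of_forall hb))
      (hk.bdd_mul hg.aestronglyMeasurable (Eventually.of_forall hb'))]
    simp [add_mul]
  · have hF' := fun n => hw.memLp_mul (μ := μ) hr1 hr (hF n) (hFc n)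
    have hb := hw.memLp_mul (μ := μ) hr1 hr (f := fun _ => (c : ℂ)) measurable_const
      (c := |c|) (fun x => by simp)
    have hle : ∀ (a : ℝ≥0) (z : ℂ), ‖z‖ ≤ c → ‖(a : ℂ) * z‖ ≤ ‖(a : ℂ) * (c : ℂ)‖ := by
      intro a z hz
      rw [norm_mul, norm_mul]
      gcongr
      simpa using hz.trans (le_abs_self c)
    have h1 := tendsto_toLp_of_dominated hr _ _ _ hF' hwf hb (fun n x => hle _ _ (hFc n x))
      (fun x => hle _ _ (hfc x)) (fun x => (hlim x).const_mul _)
    have h2 := (Φ.continuous.tendsto _).comp h1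
    have h3 : Tendsto (fun n => ∫ x, F n x * k x ∂weighted μ w) atTop
        (𝓝 (∫ x, f x * k x ∂weighted μ w)) := by
      refine tendsto_integral_of_dominated_convergence (fun x => c * ‖k x‖)
        (fun n => (hF n).aestronglyMeasurable.mul hk.1) (hk.norm.const_mul c)
        (fun n => Eventually.of_forall fun x => ?_)
        (Eventually.of_forall fun x => (hlim x).mul_const _)
      rw [norm_mul]
      gcongr
      exact hFc n x
    refine tendsto_nhds_unique h2 ?_
    simpa only [Function.comp_def, hP] using h3

/-- Weighted bounded functions are dense in `L^r`, `r < ∞`: a functional vanishing on them is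
zero. -/
theorem IsWeight.eq_zero_of_apply_eq_zero (hw : IsWeight μ w) (hr : r ≠ ∞) (Φ : Lp ℂ r μ →L[ℂ] ℂ)
    (h : ∀ (f : X → ℂ), Measurable f → (∃ c, ∀ x, ‖f x‖ ≤ c) →
      ∀ hwf : MemLp (fun x => (w x : ℂ) * f x) r μ, Φ (hwf.toLp _) = 0) (u : Lp ℂ r μ) :
    Φ u = 0 := by
  have hr1 : 1 ≤ r := Fact.out
  have hum : Measurable u := (Lp.stronglyMeasurable u).measurable
  have hwm := hw.measurable
  -- `u` is the limit of its truncations to the sets `{‖u‖ ≤ n w}`, which exhaust the space.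
  set S : ℕ → Set X := fun n => {x | ‖u x‖ ≤ n * w x} with hS
  have hSm : ∀ n, MeasurableSet (S n) := fun n => measurableSet_le hum.norm (by fun_prop)
  set F : ℕ → X → ℂ := fun n => (S n).indicator u with hF
  have hF' : ∀ n, MemLp (F n) r μ := fun n => (Lp.memLp u).indicator (hSm n)
  have hlim : ∀ x, Tendsto (fun n => F n x) atTop (𝓝 (u x)) := fun x => by
    have hx : (0 : ℝ) < w x := by exact_mod_cast hw.pos x
    refine tendsto_const_nhds.congr' ?_
    filter_upwards [eventually_ge_atTop ⌈‖u x‖ / w x⌉₊] with n hn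
    have : x ∈ S n := by
      have h1 : ‖u x‖ / w x ≤ n := (Nat.le_ceil _).trans (by exact_mod_cast hn)
      rwa [div_le_iff₀ hx] at h1
    simp [hF, this]
  have h1 := tendsto_toLp_of_dominated hr F u u hF' (Lp.memLp u) (Lp.memLp u)
    (fun n x => by by_cases hx : x ∈ S n <;> simp [hF, hx]) (fun _ => le_rfl) hlim
  rw [Lp.toLp_coeFn] at h1
  refine tendsto_nhds_unique ((Φ.continuous.tendsto _).comp h1) ?_
  refine tendsto_const_nhds.congr fun n => ?_
  have heq : F n = fun x => (w x : ℂ) * ((S n).indicator (fun x => u x / w x) x) := by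
    funext x
    have hx : (w x : ℂ) ≠ 0 := by simpa using (hw.pos x).ne'
    by_cases hxS : x ∈ S n
    · simp [hF, hxS]; field_simp
    · simp [hF, hxS]
  have h2 := hF' n
  rw [heq] at h2
  have h3 := h ((S n).indicator fun x => u x / w x) ((hum.div (by fun_prop)).indicator (hSm n))
    ⟨n, fun x => ?_⟩ h2
  · rw [Function.comp_apply, ← h3]
    congr 1
    exact MemLp.toLp_congr _ _ (Eventually.of_forall fun x => congrFun heq.symm x)
  · by_cases hx : x ∈ S n
    · have hx0 : (0 : ℝ) < w x := by exact_mod_cast hw.pos x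
      simp only [hx, Set.indicator_of_mem, norm_div]
      rw [show ‖(w x : ℂ)‖ = w x by simp, div_le_iff₀ hx0]
      exact hx
    · simp [hx]

/-- A bounded functional on `L^r`, `r < ∞`, is given on weighted bounded functions by an
`L^1`-density. -/
theorem IsWeight.exists_density (hw : IsWeight μ w) (hr : r ≠ ∞) (Φ : Lp ℂ r μ →L[ℂ] ℂ) :
    ∃ k : X → ℂ, Measurable k ∧ Integrable k (weighted μ w) ∧
      ∀ (f : X → ℂ), Measurable f → ∀ c : ℝ, (∀ x, ‖f x‖ ≤ c) →
        ∀ hwf : MemLp (fun x => (w x : ℂ) * f x) r μ,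
          Φ (hwf.toLp _) = ∫ x, f x * k x ∂weighted μ w := by
  classical
  have hr1 : 1 ≤ r := Fact.out
  have hfin := hw.isFiniteMeasure
  have hp : 0 < r.toReal := ENNReal.toReal_pos (zero_lt_one.trans_le hr1).ne' hr
  have hi : ∀ E : Set X, MeasurableSet E →
      MemLp (fun x => (w x : ℂ) * E.indicator (fun _ => 1) x) r μ := fun E hE =>
    hw.memLp_mul hr1 hr (measurable_const.indicator hE) (c := 1)
      (fun x => by by_cases hx : x ∈ E <;> simp [hx])
  set ν : Set X → ℂ := fun E => if h : MeasurableSet E then Φ ((hi E h).toLp _) else 0 with hν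
  have hνE : ∀ E (hE : MeasurableSet E), ν E = Φ ((hi E hE).toLp _) := fun E hE => by
    simp [hν, hE]
  obtain ⟨k, hkm, hki, hk⟩ := exists_density_of_le_rpow (weighted μ w) ν ‖Φ‖ (1 / r.toReal)
    (by positivity) (fun E F hE hF hd => by
      rw [hνE _ (hE.union hF), hνE _ hE, hνE _ hF, ← map_add, ← MemLp.toLp_add]
      congr 1
      refine MemLp.toLp_congr _ _ (Eventually.of_forall fun x => ?_)
      simp [Set.indicator_union_of_disjoint hd, mul_add]) (fun E hE => by
      rw [hνE _ hE]
      refine (Φ.le_opNorm _).trans ?_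
      gcongr
      rw [Lp.norm_toLp, measureReal_def, ENNReal.toReal_rpow]
      exact ENNReal.toReal_mono (ENNReal.rpow_ne_top_of_nonneg (by positivity)
        (measure_ne_top _ _)) (hw.eLpNorm_indicator_le hr1 hr hE))
  exact ⟨k, hkm, hki, hw.apply_eq_integral hr Φ k hki fun E hE _ => by rw [← hk E hE, hνE E hE]⟩

end Duality

/-! ### Norm estimates by testing -/

section Duality

variable {X : Type*} [MeasurableSpace X] {μ : Measure X} {w : X → ℝ≥0} {r : ℝ≥0∞}

/-- A phase `φ` with `φ z * z = ‖z‖`. -/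
def phase (z : ℂ) : ℂ := starRingEnd ℂ z / ‖z‖

theorem measurable_phase : Measurable phase := by
  unfold phase
  exact (Complex.continuous_conj.measurable).div (by fun_prop)

theorem phase_mul (z : ℂ) : phase z * z = ‖z‖ := by
  by_cases hz : z = 0
  · simp [hz, phase]
  · have : (‖z‖ : ℂ) ≠ 0 := by simpa using hz
    rw [phase, div_mul_eq_mul_div, mul_comm, Complex.mul_conj', sq, mul_div_assoc, div_self this,
      mul_one]

theorem norm_phase_le (z : ℂ) : ‖phase z‖ ≤ 1 := by
  rw [phase, norm_div, RCLike.norm_conj, Complex.norm_real, norm_norm]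
  exact div_self_le_one _

theorem norm_phase {z : ℂ} (hz : z ≠ 0) : ‖phase z‖ = 1 := by
  rw [phase, norm_div, RCLike.norm_conj, Complex.norm_real, norm_norm]
  exact div_self (norm_ne_zero_iff.2 hz)

/-- Norm estimate by testing for the exponent `1`. -/
theorem IsWeight.ae_norm_le_of_test (hw : IsWeight μ w) (k : X → ℂ) (hkm : Measurable k)
    (hk : Integrable k (weighted μ w)) (C : ℝ)
    (h : ∀ (f : X → ℂ), Measurable f → ∀ c : ℝ, (∀ x, ‖f x‖ ≤ c) →
      ‖∫ x, f x * k x ∂weighted μ w‖ ≤ C * (eLpNorm (fun x => (w x : ℂ) * f x) 1 μ).toReal)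
    (hC : 0 ≤ C) : ∀ᵐ x ∂μ, ‖k x‖ ≤ C := by
  have hfin := hw.isFiniteMeasure
  rw [← hw.ae_weighted_iff]
  refine ae_le_of_forall_setIntegral_le hk.norm (integrable_const C) fun s hs _ => ?_
  have h1 := h (s.indicator fun x => phase (k x)) ((measurable_phase.comp hkm).indicator hs) 1
    (fun x => by by_cases hx : x ∈ s <;> simp [hx, norm_phase_le])
  have h2 : ∫ x, s.indicator (fun x => phase (k x)) x * k x ∂weighted μ w
      = ((∫ x in s, ‖k x‖ ∂weighted μ w : ℝ) : ℂ) := by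
    rw [← integral_complex_ofReal, ← integral_indicator hs]
    refine integral_congr_ae (Eventually.of_forall fun x => ?_)
    by_cases hx : x ∈ s <;> simp [hx, phase_mul]
  have h3 : eLpNorm (fun x => (w x : ℂ) * s.indicator (fun x => phase (k x)) x) 1 μ
      ≤ weighted μ w s := by
    refine le_trans ?_ ((hw.eLpNorm_indicator_le le_rfl ENNReal.one_ne_top hs).trans_eq (by simp))
    refine eLpNorm_mono fun x => ?_
    by_cases hx : x ∈ s <;> simp [hx]
    exact mul_le_of_le_one_right (by positivity) (norm_phase_le _)
  rw [h2, Complex.norm_real, Real.norm_of_nonneg (integral_nonneg fun _ => norm_nonneg _)] at h1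
  refine h1.trans ?_
  rw [setIntegral_const, smul_eq_mul, mul_comm]
  gcongr
  exact ENNReal.toReal_mono (measure_ne_top _ _) h3

/-- If `I < ∞` satisfies `I ≤ C I ^ (1 / p)` then `I ≤ C ^ q` for the conjugate exponent `q`. -/
theorem le_rpow_of_le_mul_rpow {p q : ℝ} (hpq : p.HolderConjugate q) {I C : ℝ≥0∞} (hI : I ≠ ∞)
    (h : I ≤ C * I ^ (1 / p)) : I ≤ C ^ q := by
  by_cases h0 : I = 0
  · simp [h0]
  have hq := hpq.symm.pos
  have hp := hpq.pos
  have h1 : I = I ^ (1 / q) * I ^ (1 / p) := by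
    rw [← ENNReal.rpow_add _ _ h0 hI, one_div, one_div, add_comm, hpq.inv_add_inv_eq_one,
      ENNReal.rpow_one]
  have h2 : I ^ (1 / q) ≤ C := by
    have h2 : I ^ (1 / q) * I ^ (1 / p) ≤ C * I ^ (1 / p) := h1 ▸ h
    have h3 : I ^ (1 / p) ≠ 0 := by simp [h0, hI]
    have h4 : I ^ (1 / p) ≠ ∞ := ENNReal.rpow_ne_top_of_nonneg (by positivity) hI
    exact (ENNReal.mul_le_mul_iff_left h3 h4).1 h2
  calc I = (I ^ (1 / q)) ^ q := by
        rw [← ENNReal.rpow_mul, one_div_mul_cancel hq.ne', ENNReal.rpow_one]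
    _ ≤ C ^ q := by gcongr

/-- Norm estimate by testing for exponents in `(1, ∞)`: the test functions are truncations of
`phase k * ‖k‖ ^ (q - 1) / w`. -/
theorem IsWeight.lintegral_rpow_le_of_test (hw : IsWeight μ w) (hr1 : 1 ≤ r) (hr : r ≠ ∞) {q : ℝ}
    (hpq : r.toReal.HolderConjugate q) (k : X → ℂ) (hkm : Measurable k)
    (C : ℝ)
    (h : ∀ (f : X → ℂ), Measurable f → ∀ c : ℝ, (∀ x, ‖f x‖ ≤ c) →
      ‖∫ x, f x * k x ∂weighted μ w‖ ≤ C * (eLpNorm (fun x => (w x : ℂ) * f x) r μ).toReal)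
    (hC : 0 ≤ C) : ∫⁻ x, ‖k x‖ₑ ^ q ∂μ ≤ ENNReal.ofReal C ^ q := by
  have hr0 : r ≠ 0 := (zero_lt_one.trans_le hr1).ne'
  have hq := hpq.symm.pos
  have hq1 := hpq.symm.lt
  have hp := hpq.pos
  have hwm := hw.measurable
  set S : ℕ → Set X := fun n => {x | ‖k x‖ ≤ n ∧ 1 ≤ n * (w x : ℝ)} with hS
  have hSm : ∀ n, MeasurableSet (S n) := fun n =>
    (measurableSet_le hkm.norm measurable_const).inter
      (measurableSet_le measurable_const (measurable_const.mul hwm.coe_nnreal_real))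
  have hSmono : Monotone S := fun a b hab x hx => by
    have : (a : ℝ) ≤ b := by exact_mod_cast hab
    exact ⟨hx.1.trans this, hx.2.trans (by gcongr)⟩
  have hSU : ⋃ n, S n = Set.univ := by
    refine Set.eq_univ_of_forall fun x => Set.mem_iUnion.2 ?_
    have hx : (0 : ℝ) < w x := by exact_mod_cast hw.pos x
    refine ⟨⌈max ‖k x‖ (1 / w x)⌉₊, (le_max_left _ _).trans (Nat.le_ceil _), ?_⟩
    rw [← div_le_iff₀ hx]
    exact (le_max_right _ _).trans (Nat.le_ceil _)
  have hwn : ∀ x, ‖(w x : ℂ)‖ = w x := fun x => by simp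
  have hSn : ∀ n, ∫⁻ x in S n, ‖k x‖ₑ ^ q ∂μ ≤ ENNReal.ofReal C ^ q := by
    intro n
    set ψ : X → ℂ := fun x => phase (k x) * ((‖k x‖ ^ (q - 1) : ℝ) : ℂ) with hψ
    have hψm : Measurable ψ := (measurable_phase.comp hkm).mul (by fun_prop)
    have hψn : ∀ x, ‖ψ x‖ = ‖k x‖ ^ (q - 1) := fun x => by
      by_cases hx : k x = 0
      · simp [hψ, hx, Real.zero_rpow (sub_pos.2 hq1).ne']
      · simp only [hψ, norm_mul, norm_phase hx, one_mul, Complex.norm_real]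
        exact Real.norm_of_nonneg (by positivity)
    have hψk : ∀ x, ψ x * k x = ((‖k x‖ ^ q : ℝ) : ℂ) := fun x => by
      simp only [hψ]
      rw [mul_right_comm, phase_mul, ← Complex.ofReal_mul]
      congr 1
      by_cases hx : k x = 0
      · simp [hx, Real.zero_rpow hq.ne']
      · have : 0 < ‖k x‖ := norm_pos_iff.2 hx
        rw [← Real.rpow_one_add' this.le (by linarith)]
        congr 1; ring
    have hx0 : ∀ x, (w x : ℂ) ≠ 0 := fun x => by simpa using (hw.pos x).ne'
    -- on `S n` the measure `μ` is at most `n` times the finite measure `w μ`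
    have hμS : μ (S n) ≠ ∞ := by
      have h1 : μ (S n) ≤ n * weighted μ w (S n) := by
        rw [weighted, withDensity_apply _ (hSm n), ← lintegral_const_mul _ (by fun_prop),
          ← setLIntegral_one]
        refine setLIntegral_mono (by fun_prop) fun x hx => ?_
        have := hx.2
        exact_mod_cast this
      have := hw.isFiniteMeasure
      exact ne_top_of_le_ne_top (ENNReal.mul_ne_top (by simp) (measure_ne_top _ _)) h1
    have hI : ∫⁻ x in S n, ‖k x‖ₑ ^ q ∂μ ≠ ∞ := by
      have h1 : ∫⁻ x in S n, ‖k x‖ₑ ^ q ∂μ ≤ ∫⁻ x in S n, (n : ℝ≥0∞) ^ q ∂μ := by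
        refine setLIntegral_mono (by fun_prop) fun x hx => ?_
        gcongr
        rw [← ofReal_norm, ← ENNReal.ofReal_natCast]
        exact ENNReal.ofReal_le_ofReal hx.1
      refine ne_top_of_le_ne_top ?_ h1
      rw [setLIntegral_const]
      exact ENNReal.mul_ne_top (by simp [hq.le]) hμS
    refine le_rpow_of_le_mul_rpow hpq hI ?_
    have h1 := h ((S n).indicator fun x => ψ x / w x) ((hψm.div (by fun_prop)).indicator (hSm n))
      ((n : ℝ) ^ (q - 1) * n) (fun x => by
        by_cases hx : x ∈ S n
        · have hx0 : (0 : ℝ) < w x := by exact_mod_cast hw.pos x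
          simp only [hx, Set.indicator_of_mem]
          rw [norm_div, hψn, hwn, div_eq_mul_inv]
          gcongr
          · exact hx.1
          · rw [inv_le_iff_one_le_mul₀ hx0]
            exact hx.2
        · simp only [hx, not_false_eq_true, Set.indicator_of_notMem, norm_zero]
          positivity)
    have h2 : ∫ x, (S n).indicator (fun x => ψ x / w x) x * k x ∂weighted μ w
        = ((∫⁻ x in S n, ‖k x‖ₑ ^ q ∂μ).toReal : ℂ) := by
      rw [hw.integral_weighted]
      have h3 : ∀ x, (w x : ℂ) * ((S n).indicator (fun x => ψ x / w x) x * k x)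
          = (S n).indicator (fun x => ((‖k x‖ ^ q : ℝ) : ℂ)) x := fun x => by
        have := hx0 x
        by_cases hx : x ∈ S n
        · simp only [hx, Set.indicator_of_mem]
          rw [← hψk]; field_simp
        · simp [hx]
      simp_rw [h3]
      rw [integral_indicator (hSm n), integral_complex_ofReal, integral_eq_lintegral_of_nonneg_ae
        (Eventually.of_forall fun x => by positivity) (hkm.norm.pow_const q).aestronglyMeasurable]
      congr 2
      refine lintegral_congr fun x => ?_
      rw [← ENNReal.ofReal_rpow_of_nonneg (norm_nonneg _) hq.le, ofReal_norm]
    have h4 : eLpNorm (fun x => (w x : ℂ) * (S n).indicator (fun x => ψ x / w x) x) r μ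
        = (∫⁻ x in S n, ‖k x‖ₑ ^ q ∂μ) ^ (1 / r.toReal) := by
      rw [eLpNorm_eq_lintegral_rpow_enorm_toReal hr0 hr, ← lintegral_indicator (hSm n)]
      congr 1
      refine lintegral_congr fun x => ?_
      have := hx0 x
      by_cases hx : x ∈ S n
      · simp only [hx, Set.indicator_of_mem]
        rw [mul_div_cancel₀ _ this, ← ofReal_norm, hψn, ← ofReal_norm,
          ENNReal.ofReal_rpow_of_nonneg (by positivity) hp.le,
          ENNReal.ofReal_rpow_of_nonneg (by positivity) hq.le, ← Real.rpow_mul (norm_nonneg _),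
          hpq.symm.sub_one_mul_conj]
      · simp [hx, hp]
    rw [h2, h4, Complex.norm_real, Real.norm_of_nonneg ENNReal.toReal_nonneg] at h1
    rw [← ENNReal.ofReal_toReal hI]
    refine (ENNReal.ofReal_le_ofReal h1).trans_eq ?_
    rw [ENNReal.ofReal_mul hC, ENNReal.ofReal_toReal, ENNReal.ofReal_toReal hI]
    exact ENNReal.rpow_ne_top_of_nonneg (by positivity) hI
  have h5 := setLIntegral_iUnion_of_directed (μ := μ) (fun x => ‖k x‖ₑ ^ q) hSmono.directed_le
  rw [hSU, Measure.restrict_univ] at h5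
  rw [h5]
  exact iSup_le hSn

end Duality

/-! ### The dual of `L^r` -/

section Duality

variable {X : Type*} [MeasurableSpace X] {μ : Measure X} {r r' : ℝ≥0∞} [Fact (1 ≤ r)]
  [Fact (1 ≤ r')] [ENNReal.HolderConjugate r r']

/-- The dual of `L^r` is `L^{r'}` for `1 ≤ r < ∞` and σ-finite measures. -/
theorem exists_pairing_eq [SigmaFinite μ] (hr : r ≠ ∞) (Φ : Lp ℂ r μ →L[ℂ] ℂ) :
    ∃ g : Lp ℂ r' μ, (∀ f : Lp ℂ r μ, pairing r' f g = Φ f) ∧ ‖g‖ ≤ ‖Φ‖ := by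
  have hr1 : 1 ≤ r := Fact.out
  obtain ⟨w, hw⟩ := exists_isWeight μ
  obtain ⟨k, hkm, hki, hk⟩ := hw.exists_density hr Φ
  have htest : ∀ (f : X → ℂ), Measurable f → ∀ c : ℝ, (∀ x, ‖f x‖ ≤ c) →
      ‖∫ x, f x * k x ∂weighted μ w‖ ≤ ‖Φ‖ * (eLpNorm (fun x => (w x : ℂ) * f x) r μ).toReal := by
    intro f hf c hc
    have hwf := hw.memLp_mul (μ := μ) hr1 hr hf hc
    rw [← hk f hf c hc hwf, ← Lp.norm_toLp _ hwf]
    exact Φ.le_opNorm _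
  have hnorm : eLpNorm k r' μ ≤ ENNReal.ofReal ‖Φ‖ := by
    by_cases hr' : r' = ∞
    · subst hr'
      obtain rfl : r = 1 := by
        simpa using ENNReal.HolderConjugate.inv_add_inv_eq_one r ∞
      rw [eLpNorm_exponent_top]
      refine eLpNormEssSup_le_of_ae_bound ?_
      exact hw.ae_norm_le_of_test k hkm hki ‖Φ‖ htest (norm_nonneg _)
    · have hpq := ENNReal.HolderConjugate.toReal_of_ne_top hr hr'
      have hr'0 : r' ≠ 0 := (zero_lt_one.trans_le (Fact.out : 1 ≤ r')).ne'
      rw [eLpNorm_eq_lintegral_rpow_enorm_toReal hr'0 hr', one_div,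
        ENNReal.rpow_inv_le_iff hpq.symm.pos]
      exact hw.lintegral_rpow_le_of_test hr1 hr hpq k hkm ‖Φ‖ htest (norm_nonneg _)
  have hkL : MemLp k r' μ := ⟨hkm.aestronglyMeasurable, hnorm.trans_lt ENNReal.ofReal_lt_top⟩
  refine ⟨hkL.toLp k, fun f => ?_, ?_⟩
  · have h0 := hw.eq_zero_of_apply_eq_zero hr
      (((ContinuousLinearMap.mul ℂ ℂ).lpPairing μ r r').flip (hkL.toLp k) - Φ)
      (fun f hf ⟨c, hc⟩ hwf => by
        rw [_root_.sub_apply, hk f hf c hc hwf, sub_eq_zero, ContinuousLinearMap.flip_apply,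
          hw.integral_weighted]
        refine (pairing_eq r' _ _).trans (integral_congr_ae ?_)
        filter_upwards [hwf.coeFn_toLp, hkL.coeFn_toLp] with x h1 h2
        rw [h1, h2, mul_assoc]) f
    exact sub_eq_zero.1 h0
  · rw [Lp.norm_toLp]
    exact ENNReal.toReal_le_of_le_ofReal (norm_nonneg _) hnorm

/-- An element of `L^{r'}` is determined by its pairings with `L^r`. -/
theorem eq_zero_of_pairing_eq_zero [SigmaFinite μ] (h : Lp ℂ r' μ)
    (h0 : ∀ f : Lp ℂ r μ, pairing r' f h = 0) : h = 0 := by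
  refine (Lp.eq_zero_iff_ae_eq_zero).2 (ae_eq_zero_of_forall_setIntegral_eq_of_sigmaFinite
    (fun s _ hμs => ?_) fun s hs hμs => ?_)
  · have : IsFiniteMeasure (μ.restrict s) := ⟨by simpa using hμs⟩
    exact ((Lp.memLp h).restrict s).integrable Fact.out
  · have h1 := h0 (indicatorConstLp r hs hμs.ne (1 : ℂ))
    rw [pairing_eq] at h1
    rw [← integral_indicator hs, ← h1]
    refine integral_congr_ae ?_
    filter_upwards [indicatorConstLp_coeFn (p := r) (hs := hs) (hμs := hμs.ne) (c := (1 : ℂ))]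
      with x hx
    rw [hx]
    by_cases hxs : x ∈ s <;> simp [hxs]

theorem norm_le_of_norm_pairing_le [SigmaFinite μ] (hr : r ≠ ∞) (g : Lp ℂ r' μ) (C : ℝ)
    (hC : 0 ≤ C) (h : ∀ f : Lp ℂ r μ, ‖pairing r' f g‖ ≤ C * ‖f‖) : ‖g‖ ≤ C := by
  set Φ : Lp ℂ r μ →L[ℂ] ℂ := ((ContinuousLinearMap.mul ℂ ℂ).lpPairing μ r r').flip g with hΦ
  obtain ⟨g', hg', hn⟩ := exists_pairing_eq (r' := r') hr Φ
  have : g' - g = 0 := eq_zero_of_pairing_eq_zero (r := r) _ fun f => by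
    rw [map_sub, hg', sub_eq_zero]; rfl
  rw [← sub_eq_zero.1 this]
  exact hn.trans (Φ.opNorm_le_bound hC h)

end Duality

theorem integrable_mul_of_Lp {X : Type*} [MeasurableSpace X] {μ : Measure X} {r r' : ℝ≥0∞}
    [ENNReal.HolderConjugate r r'] (g : Lp ℂ r' μ) (f : Lp ℂ r μ) :
    Integrable (fun y => g y * f y) μ :=
  (Lp.memLp f).integrable_mul (Lp.memLp g) |>.congr (Eventually.of_forall fun y => by
    simp [mul_comm])

/-! ### Smoothing of bounded analytic semigroups -/

section Semigroup

variable {E : Type*} [NormedAddCommGroup E] [NormedSpace ℂ E]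

theorem opPow_succ_graph {A : E →ₗ.[ℂ] E} {k : ℕ} {f g h : E} (h1 : (f, g) ∈ (opPow A k).graph)
    (h2 : (g, h) ∈ A.graph) : (f, h) ∈ (opPow A (k + 1)).graph := by
  rw [LinearPMap.mem_graph_iff] at h1 h2 ⊢
  obtain ⟨x, hx, hxg⟩ := h1
  obtain ⟨y, hy, hyh⟩ := h2
  simp only at hx hxg hy hyh
  subst hx hxg hyh
  have hmem : opPow A k x ∈ A.domain := hy ▸ y.2
  refine ⟨⟨x, ⟨x, hmem, rfl⟩, x.2⟩, rfl, ?_⟩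
  change A ⟨opPow A k x, hmem⟩ = A y
  congr 1
  exact Subtype.ext hy.symm

/-- A sector contains the discs of radius `c t` around all `t > 0`, by homogeneity. -/
theorem exists_closedBall_subset_sector {δ : ℝ} (hδ : 0 < δ) :
    ∃ c : ℝ, 0 < c ∧ ∀ t : ℝ, 0 < t → Metric.closedBall (t : ℂ) (c * t) ⊆ sector δ := by
  have h1 : sector δ ∈ 𝓝 (1 : ℂ) := by
    have ha : ContinuousAt Complex.arg 1 := Complex.continuousAt_arg (by simp)
    have h2 : ∀ᶠ z in 𝓝 (1 : ℂ), |z.arg| < δ := by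
      have := ha.abs.tendsto
      simp only [Complex.arg_one, abs_zero] at this
      exact this.eventually (gt_mem_nhds hδ)
    filter_upwards [h2, isOpen_ne.mem_nhds (one_ne_zero : (1 : ℂ) ≠ 0)] with z hz hz0
    exact ⟨hz0, hz⟩
  obtain ⟨c, hc, hsub⟩ := Metric.nhds_basis_closedBall.mem_iff.1 h1
  refine ⟨c, hc, fun t ht z hz => ?_⟩
  have ht' : (t : ℂ) ≠ 0 := by exact_mod_cast ht.ne'
  have h3 : z / t ∈ sector δ := hsub (by
    rw [Metric.mem_closedBall, dist_eq_norm] at hz ⊢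
    have : z / t - 1 = (z - t) / t := by field_simp
    rw [this, norm_div, Complex.norm_real, Real.norm_of_nonneg ht.le]
    exact div_le_of_le_mul₀ ht.le hc.le hz)
  have h4 : z = (t : ℂ) * (z / t) := by field_simp
  rw [h4]
  refine ⟨mul_ne_zero ht' h3.1, ?_⟩
  rw [Complex.arg_real_mul _ ht]
  exact h3.2

/-- For a bounded analytic semigroup, `T` is bounded and has a norm derivative `D` with
`‖D t‖ ≤ N / t`, by the Cauchy estimate on a disc of radius proportional to `t`. -/
theorem IsBoundedAnalytic.exists_deriv {T : ℝ → E →L[ℂ] E} (hT : IsBoundedAnalytic T) :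
    ∃ (D : ℝ → E →L[ℂ] E) (N : ℝ), 0 < N ∧ ∀ t : ℝ, 0 < t →
      ‖T t‖ ≤ N ∧ ‖D t‖ ≤ N / t ∧
      ∀ f, Tendsto (fun h : ℝ => ((h : ℂ)⁻¹) • (T (t + h) f - T t f)) (𝓝[>] 0) (𝓝 (D t f)) := by
  obtain ⟨δ, hδ, -, S, hST, -, hd, hb⟩ := hT
  obtain ⟨⟨M, hM⟩, -⟩ := hb (δ / 2) (by linarith) (by linarith)
  obtain ⟨c, hc, hsub⟩ := exists_closedBall_subset_sector (δ := δ / 2) (by linarith)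
  have hss : sector (δ / 2) ⊆ sector δ := fun z hz => ⟨hz.1, hz.2.trans (by linarith)⟩
  have hM' : ∀ t : ℝ, 0 < t → ‖S t‖ ≤ M := fun t ht =>
    hM _ (hsub t ht (Metric.mem_closedBall_self (by positivity)))
  have hM0 : 0 ≤ M := (norm_nonneg _).trans (hM' 1 one_pos)
  refine ⟨fun t => deriv S t, max (M / c) M + 1, by positivity, fun t ht => ⟨?_, ?_, fun f => ?_⟩⟩
  · rw [← hST t ht]
    exact (hM' t ht).trans ((le_max_right _ _).trans (le_add_of_nonneg_right zero_le_one))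
  · have h1 : DifferentiableOn ℂ S (Metric.closedBall (t : ℂ) (c * t)) :=
      hd.mono ((hsub t ht).trans hss)
    have h2 := Complex.norm_deriv_le_of_forall_mem_sphere_norm_le (by positivity : 0 < c * t)
      (h1.diffContOnCl_ball subset_rfl) (C := M)
      fun z hz => hM z (hsub t ht (Metric.sphere_subset_closedBall hz))
    refine h2.trans ?_
    rw [← div_div]
    gcongr
    exact (le_max_left _ _).trans (le_add_of_nonneg_right zero_le_one)
  · have h1 : DifferentiableAt ℂ S t := hd.differentiableAt
      (Filter.mem_of_superset (Metric.closedBall_mem_nhds (t : ℂ) (by positivity : 0 < c * t))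
        ((hsub t ht).trans hss))
    have h2 := (hasDerivAt_iff_tendsto_slope_zero.1 h1.hasDerivAt)
    have h3 : Tendsto (fun h : ℝ => (h : ℂ)) (𝓝[>] 0) (𝓝[≠] 0) := by
      refine tendsto_nhdsWithin_iff.2 ⟨?_, ?_⟩
      · exact (Complex.continuous_ofReal.tendsto' 0 0 (by simp)).mono_left nhdsWithin_le_nhds
      · filter_upwards [self_mem_nhdsWithin] with h hh
        have : h ≠ 0 := (Set.mem_Ioi.1 hh).ne'
        simpa using this
    have h4 := ((ContinuousLinearMap.apply ℂ E f).continuous.tendsto _).comp (h2.comp h3)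
    refine h4.congr' ?_
    filter_upwards [self_mem_nhdsWithin] with h hh
    have hh' : 0 < h := hh
    simp only [Function.comp_apply, map_smul, map_sub, ContinuousLinearMap.apply_apply]
    rw [← Complex.ofReal_add, hST _ ht, hST _ (by linarith)]

/-- Smoothing of a bounded analytic semigroup with generator `A`: `T t` maps into `D(A ^ k)`, the
operator `A T t` extends `T t A` and also maps into `D(A ^ k)`, and
`A ^ k T t = O(t ^ (-k))`, `A ^ (k + 1) T t = O(t ^ (-(k + 1)))`. -/
theorem exists_smoothing (A : E →ₗ.[ℂ] E) (T : ℝ → E →L[ℂ] E) (hT : IsC0Semigroup T)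
    (hAT : IsGenerator A T) (hTa : IsBoundedAnalytic T) (k : ℕ) (hk : 1 ≤ k) :
    ∃ N : ℝ, 0 < N ∧ ∀ t : ℝ, 0 < t → ‖T t‖ ≤ N ∧ ∃ P D Q : E →L[ℂ] E,
      (∀ f, (T t f, P f) ∈ (opPow A k).graph) ∧ ‖P‖ ≤ N / t ^ k ∧
      (∀ f g, (f, g) ∈ A.graph → T t g = D f) ∧ ‖D‖ ≤ N / t ∧
      (∀ f, (D f, Q f) ∈ (opPow A k).graph) ∧ ‖Q‖ ≤ N / t ^ (k + 1) := by
  obtain ⟨D, N, hN, hD⟩ := hTa.exists_deriv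
  have hTT : ∀ s t f, 0 ≤ s → 0 ≤ t → T (s + t) f = T s (T t f) := fun s t f hs ht => by
    rw [hT.add s t hs ht]; rfl
  have hgraph : ∀ t, 0 < t → ∀ f, (T t f, D t f) ∈ A.graph := fun t ht f => by
    rw [hAT]
    refine ((hD t ht).2.2 f).congr' ?_
    filter_upwards [self_mem_nhdsWithin] with h hh
    have hh' : 0 < h := hh
    rw [add_comm t h, hTT h t f hh'.le ht.le]
  have hcomm : ∀ t, 0 < t → ∀ f g, (f, g) ∈ A.graph → T t g = D t f := fun t ht f g hfg => by
    have h1 := ((T t).continuous.tendsto _).comp ((hAT f g).1 hfg)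
    refine tendsto_nhds_unique h1 (((hD t ht).2.2 f).congr' ?_)
    filter_upwards [self_mem_nhdsWithin] with h hh
    have hh' : 0 < h := hh
    simp only [Function.comp_apply, map_smul, map_sub]
    rw [hTT t h f ht.le hh'.le]
  have hTD : ∀ t, 0 < t → ∀ f, T t (D t f) = D t (T t f) := fun t ht f =>
    hcomm t ht _ _ (hgraph t ht f)
  have hpowcomm : ∀ t, 0 < t → ∀ (j : ℕ) f, T t ((D t ^ j) f) = (D t ^ j) (T t f) := by
    intro t ht j
    induction j with
    | zero => intro f; simp
    | succ j ih =>
      intro f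
      rw [pow_succ', mul_apply_eq_comp, hTD t ht, ih]
      rfl
  have hpow : ∀ t, 0 < t → ∀ (j : ℕ) f, (T (j * t) f, (D t ^ j) f) ∈ (opPow A j).graph := by
    intro t ht j
    induction j with
    | zero =>
      intro f
      simp only [CharP.cast_eq_zero, zero_mul, hT.zero, pow_zero]
      rw [LinearPMap.mem_graph_iff]
      exact ⟨⟨f, trivial⟩, rfl, rfl⟩
    | succ j ih =>
      intro f
      have h1 := ih (T t f)
      rw [← hTT _ _ _ (by positivity) ht.le, ← hpowcomm t ht] at h1
      have h2 := opPow_succ_graph h1 (hgraph t ht _)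
      rw [pow_succ', mul_apply_eq_comp]
      rwa [show (j : ℝ) * t + t = ((j + 1 : ℕ) : ℝ) * t by push_cast; ring] at h2
  have hDpow : ∀ t, 0 < t → ∀ j : ℕ, ‖D t ^ (j + 1)‖ ≤ (N / t) ^ (j + 1) := fun t ht j =>
    (norm_pow_le' _ (Nat.succ_pos j)).trans (by gcongr; exact (hD t ht).2.1)
  have hsplit : ∀ t, 0 < t → ∀ (j : ℕ) f, D ((j + 1) * t) f = T (j * t) (D t f) := by
    intro t ht j f
    by_cases hj : j = 0
    · simp [hj, hT.zero]
    have hjt : 0 < (j : ℝ) * t := by positivity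
    have h1 := hgraph ((j + 1) * t) (by positivity) f
    rw [hcomm (j * t) hjt _ _ (hgraph t ht f)]
    have h2 := hgraph (j * t) hjt (T t f)
    rw [← hTT _ _ _ hjt.le ht.le] at h2
    rw [show ((j : ℝ) + 1) * t = j * t + t by ring] at h1 ⊢
    exact A.mem_graph_snd_inj h1 h2 rfl
  -- `T t = T (t / j) ^ j` gives the bound `(N / (t / j)) ^ j` for `A ^ j T t`
  set K : ℝ := (k + 1) * N with hK
  have hk0 : (0 : ℝ) < k := by exact_mod_cast hk
  have hkey : ∀ (t : ℝ) (j : ℕ), 0 < t → 1 ≤ j → (j : ℝ) ≤ k + 1 →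
      (N / (t / j)) ^ j ≤ K ^ j / t ^ j := fun t j ht hj hjk => by
    have hj0 : (0 : ℝ) < j := by exact_mod_cast hj
    rw [← div_pow]
    refine pow_le_pow_left₀ (by positivity) ?_ j
    rw [div_div_eq_mul_div, mul_comm, hK]
    gcongr
  refine ⟨N + K ^ k + K ^ (k + 1), by positivity, fun t ht => ⟨?_, D (t / k) ^ k, D t,
    D (t / (k + 1 : ℕ)) ^ (k + 1), fun f => ?_, ?_, hcomm t ht, ?_, fun f => ?_, ?_⟩⟩
  · exact (hD t ht).1.trans (by
      have : 0 ≤ K ^ k + K ^ (k + 1) := by positivity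
      linarith)
  · have h1 := hpow (t / k) (by positivity) k f
    rwa [mul_div_cancel₀ _ hk0.ne'] at h1
  · obtain ⟨j, rfl⟩ := Nat.exists_eq_add_of_le' hk
    refine (hDpow _ (by positivity) j).trans ((hkey t _ ht hk (by linarith)).trans ?_)
    gcongr
    have : 0 ≤ N + K ^ (j + 1 + 1) := by positivity
    linarith
  · refine (hD t ht).2.1.trans ?_
    gcongr
    have : 0 ≤ K ^ k + K ^ (k + 1) := by positivity
    linarith
  · have hu : 0 < t / (k + 1 : ℕ) := by positivity
    have h1 := hpow (t / (k + 1 : ℕ)) hu k (D (t / (k + 1 : ℕ)) f)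
    rw [← hsplit _ hu] at h1
    rw [pow_succ, mul_apply_eq_comp]
    convert h1 using 3
    push_cast
    field_simp
  · refine (hDpow _ (by positivity) k).trans
      ((hkey t _ ht (by omega) (by push_cast; exact le_rfl)).trans ?_)
    gcongr
    have : 0 ≤ N + K ^ k := by positivity
    linarith

/-- The generator of a strongly continuous analytic semigroup is densely defined. -/
theorem dense_domain (A : E →ₗ.[ℂ] E) (T : ℝ → E →L[ℂ] E) (hT : IsC0Semigroup T)
    (hAT : IsGenerator A T) (hTa : IsBoundedAnalytic T) : Dense (A.domain : Set E) := by
  obtain ⟨D, N, -, hD⟩ := hTa.exists_deriv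
  intro f
  refine mem_closure_of_tendsto (hT.cont f) ?_
  filter_upwards [self_mem_nhdsWithin] with t ht
  have ht' : 0 < t := ht
  refine LinearPMap.mem_domain_iff.2 ⟨D t f, ?_⟩
  rw [hAT]
  refine ((hD t ht').2.2 f).congr' ?_
  filter_upwards [self_mem_nhdsWithin] with h hh
  have hh' : 0 < h := hh
  rw [add_comm t h, hT.add h t hh'.le ht'.le]; rfl

end Semigroup

/-! ### Evaluation functionals and their joint measurability -/

section Evaluation

variable {X : Type*} [EMetricSpace X] [MeasurableSpace X] {μ : Measure X} [SigmaFinite μ]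
  {r r' : ℝ≥0∞} [Fact (1 ≤ r)] [Fact (1 ≤ r')] [ENNReal.HolderConjugate r r']

/-- Pointwise consequences of a bound of the Hölder norm. -/
theorem bounds_of_holderENorm_le {X : Type*} [EMetricSpace X] {α : ℝ≥0} {u : X → ℂ} {b : ℝ}
    (hb : 0 ≤ b) (h : holderENorm α u ≤ ENNReal.ofReal b) :
    (∀ x, ‖u x‖ ≤ b) ∧
      ∀ x x', edist x x' ≠ ∞ → ‖u x - u x'‖ ≤ b * (edist x x').toReal ^ (α : ℝ) := by
  have h1 : (⨆ x, ‖u x‖ₑ) ≤ ENNReal.ofReal b := le_self_add.trans h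
  have h2 : eHolderNorm α u ≤ ENNReal.ofReal b := le_add_self.trans h
  refine ⟨fun x => ?_, fun x x' hx => ?_⟩
  · have := (le_iSup (fun x => ‖u x‖ₑ) x).trans h1
    rwa [← ofReal_norm, ENNReal.ofReal_le_ofReal_iff hb] at this
  · set d := (edist x x').toReal ^ (α : ℝ) with hd
    -- the infimum defining the Hölder seminorm is approached by constants `β > b`
    have hβ : ∀ β, b < β → ‖u x - u x'‖ ≤ β * d := fun β hβ => by
      have h3 : eHolderNorm α u < ENNReal.ofReal β :=
        h2.trans_lt ((ENNReal.ofReal_lt_ofReal_iff (hb.trans_lt hβ)).2 hβ)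
      simp only [eHolderNorm, iInf_lt_iff] at h3
      obtain ⟨C, hC, hCβ⟩ := h3
      have h4 := (hC x x').trans (mul_le_mul_left hCβ.le _)
      rw [edist_dist, dist_eq_norm] at h4
      have h5 := ENNReal.toReal_mono (ENNReal.mul_ne_top ENNReal.ofReal_ne_top
        (ENNReal.rpow_ne_top_of_nonneg α.coe_nonneg hx)) h4
      rwa [ENNReal.toReal_ofReal (norm_nonneg _), ENNReal.toReal_mul,
        ENNReal.toReal_ofReal (hb.trans hβ.le), ← ENNReal.toReal_rpow] at h5
    refine ge_of_tendsto (x := 𝓝[>] b) (f := fun β => β * d) ?_ ?_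
    · exact ((continuous_id.mul continuous_const).tendsto b).mono_left nhdsWithin_le_nhds
    · filter_upwards [self_mem_nhdsWithin] with β h using hβ β h

/-- Let `J` embed the domain of `L` into the Hölder functions, and let `B` be a bounded operator
into that domain with `L B = P` bounded. Then the evaluations `f ↦ J (B f) x` are represented by a
bounded and Hölder continuous family in the dual space. -/
theorem exists_dual_evaluation (hr : r ≠ ∞) {L : Lp ℂ r μ →ₗ.[ℂ] Lp ℂ r μ} {α : ℝ≥0} (hα : 0 < α)
    (J : L.domain →ₗ[ℂ] (X → ℂ)) {M : ℝ≥0} (hM : 0 < M)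
    (hJ : ∀ f : L.domain, holderENorm α (J f) ≤ (M : ℝ≥0∞) * ENNReal.ofReal (graphNorm L f))
    (B P : Lp ℂ r μ →L[ℂ] Lp ℂ r μ) (hBP : ∀ f, (B f, P f) ∈ L.graph) {c : ℝ} (hc0 : 0 < c)
    (hc : ‖B‖ + ‖P‖ ≤ c) :
    ∃ g : X → Lp ℂ r' μ, (∀ f (h : B f ∈ L.domain) x, pairing r' f (g x) = J ⟨B f, h⟩ x) ∧
      (∀ x, ‖g x‖ ≤ M * c) ∧
      ∀ x x', ENNReal.ofReal ‖g x - g x'‖ ≤ ENNReal.ofReal (M * c) * edist x x' ^ (α : ℝ) := by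
  have hdom : ∀ f, B f ∈ L.domain := fun f => LinearPMap.mem_domain_of_mem_graph (hBP f)
  have hgn : ∀ f, graphNorm L ⟨B f, hdom f⟩ ≤ c * ‖f‖ := fun f => by
    have h1 : L ⟨B f, hdom f⟩ = P f :=
      L.mem_graph_snd_inj (L.mem_graph ⟨B f, hdom f⟩) (hBP f) rfl
    rw [graphNorm, h1]
    calc ‖B f‖ + ‖P f‖ ≤ ‖B‖ * ‖f‖ + ‖P‖ * ‖f‖ := add_le_add (B.le_opNorm f) (P.le_opNorm f)
      _ ≤ c * ‖f‖ := by rw [← add_mul]; gcongr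
  have hb := fun f => bounds_of_holderENorm_le (b := M * c * ‖f‖) (by positivity)
    ((hJ ⟨B f, hdom f⟩).trans (by
      rw [mul_assoc, ENNReal.ofReal_mul NNReal.zero_le_coe, ENNReal.ofReal_coe_nnreal]
      gcongr
      exact hgn f))
  have hex : ∀ x, ∃ g : Lp ℂ r' μ, (∀ f, pairing r' f g = J ⟨B f, hdom f⟩ x) ∧ ‖g‖ ≤ M * c := by
    intro x
    let U : Lp ℂ r μ →ₗ[ℂ] ℂ :=
      LinearMap.proj x ∘ₗ J ∘ₗ (B : Lp ℂ r μ →ₗ[ℂ] Lp ℂ r μ).codRestrict L.domain hdom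
    obtain ⟨g, hg, hn⟩ := exists_pairing_eq (r' := r') hr
      (U.mkContinuous (M * c) fun f => (hb f).1 x)
    exact ⟨g, hg, hn.trans (LinearMap.mkContinuous_norm_le _ (by positivity) _)⟩
  choose g hg hn using hex
  refine ⟨g, fun f _ x => hg x f, hn, fun x x' => ?_⟩
  by_cases hx : edist x x' = ∞
  · have : 0 < (M : ℝ) * c := by positivity
    rw [hx, ENNReal.top_rpow_of_pos (by exact_mod_cast hα),
      ENNReal.mul_top (ENNReal.ofReal_pos.2 this).ne']
    exact le_top
  · have h1 := norm_le_of_norm_pairing_le (r := r) hr (g x - g x')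
      (M * c * (edist x x').toReal ^ (α : ℝ)) (by positivity) fun f => by
        rw [map_sub, hg, hg]
        exact ((hb f).2 x x' hx).trans_eq (by ring)
    refine (ENNReal.ofReal_le_ofReal h1).trans_eq ?_
    rw [ENNReal.ofReal_mul (by positivity), ENNReal.toReal_rpow,
      ENNReal.ofReal_toReal (ENNReal.rpow_ne_top_of_nonneg α.coe_nonneg hx)]

end Evaluation

section JointMeasurability

variable {X : Type*} [MeasurableSpace X] {μ : Measure X} [SigmaFinite μ]
  {r r' : ℝ≥0∞} [Fact (1 ≤ r)] [Fact (1 ≤ r')] [ENNReal.HolderConjugate r r']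

/-- Two bounded families `g`, `g'` in the dual space represent operators `B`, `B'` pointwise almost
everywhere. If `g'` annihilates the kernel of `B`, then `g'` has a jointly measurable version. -/
theorem exists_jointly_measurable (hr : r ≠ ∞) (B B' : Lp ℂ r μ →L[ℂ] Lp ℂ r μ)
    (g g' : X → Lp ℂ r' μ) (C : ℝ) (hC : ∀ x, ‖g x‖ ≤ C) (hC' : ∀ x, ‖g' x‖ ≤ C)
    (hg : ∀ f, (fun x => pairing r' f (g x)) =ᵐ[μ] B f)
    (hg' : ∀ f, (fun x => pairing r' f (g' x)) =ᵐ[μ] B' f)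
    (hker : ∀ f, B f = 0 → ∀ x, pairing r' f (g' x) = 0) :
    ∃ K : X × X → ℂ, Measurable K ∧ ∀ᵐ x ∂μ, (fun y => K (x, y)) =ᵐ[μ] g' x := by
  have hr1 : 1 ≤ r := Fact.out
  obtain ⟨w, hw⟩ := exists_isWeight μ
  have hfin := hw.isFiniteMeasure
  set b : Lp ℂ r μ →L[ℂ] Lp ℂ r' μ →L[ℂ] ℂ := (ContinuousLinearMap.mul ℂ ℂ).lpPairing μ r r'
  have hone : MemLp (fun x => (w x : ℂ) * 1) r μ :=
    hw.memLp_mul hr1 hr measurable_const (c := 1) (fun x => by simp)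
  have hpair : ∀ (f : X → ℂ) (hf : MemLp (fun x => (w x : ℂ) * f x) r μ) (u : Lp ℂ r' μ),
      pairing r' (hf.toLp _) u = ∫ y, f y * u y ∂weighted μ w := fun f hf u => by
    rw [pairing_eq, hw.integral_weighted]
    refine integral_congr_ae ?_
    filter_upwards [hf.coeFn_toLp] with y hy
    rw [hy, mul_assoc]
  have hint : ∀ u : Lp ℂ r' μ, Integrable u (weighted μ w) := fun u => by
    rw [hw.integrable_weighted_iff]
    refine (integrable_mul_of_Lp u (hone.toLp _)).congr ?_
    filter_upwards [hone.coeFn_toLp] with y hy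
    rw [hy, mul_one, mul_comm]
  -- the `L^1 (w μ)`-norm of `u` is the pairing of `u` with `w` times its phase
  have hbound : ∀ u : Lp ℂ r' μ, ‖u‖ ≤ C →
      ∫ y, ‖u y‖ ∂weighted μ w ≤ ‖b‖ * ‖hone.toLp _‖ * C := fun u hu => by
    have hph := hw.memLp_mul (μ := μ) hr1 hr (f := fun y => phase (u y))
      (measurable_phase.comp (Lp.stronglyMeasurable u).measurable) (c := 1)
      (fun x => norm_phase_le _)
    have h1 := hpair _ hph u
    simp only [phase_mul, integral_complex_ofReal] at h1
    have h2 : ∫ y, ‖u y‖ ∂weighted μ w = ‖pairing r' (hph.toLp _) u‖ := by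
      rw [h1, Complex.norm_real, Real.norm_of_nonneg (integral_nonneg fun _ => norm_nonneg _)]
    rw [h2]
    refine (b.le_opNorm₂ _ _).trans ?_
    gcongr
    rw [Lp.norm_toLp, Lp.norm_toLp]
    refine ENNReal.toReal_mono hone.2.ne (eLpNorm_mono fun x => ?_)
    rw [norm_mul, norm_mul, norm_one]
    gcongr
    exact norm_phase_le _
  have hmeas : ∀ (B : Lp ℂ r μ →L[ℂ] Lp ℂ r μ) (g : X → Lp ℂ r' μ),
      (∀ f, (fun x => pairing r' f (g x)) =ᵐ[μ] B f) → ∀ E, MeasurableSet E →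
        AEStronglyMeasurable (fun x => ∫ y in E, g x y ∂weighted μ w) (weighted μ w) := by
    intro B g hg E hE
    have hE' := hw.memLp_mul (μ := μ) hr1 hr (f := E.indicator fun _ => 1)
      (measurable_const.indicator hE) (c := 1) (fun x => by by_cases hx : x ∈ E <;> simp [hx])
    have h1 : AEStronglyMeasurable (fun x => pairing r' (hE'.toLp _) (g x)) μ :=
      (Lp.aestronglyMeasurable _).congr (hg _).symm
    refine (h1.mono_ac (IsWeight.weighted_absolutelyContinuous μ w)).congr
      (Eventually.of_forall fun x => ?_)
    simp only
    rw [hpair, ← integral_indicator hE]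
    refine integral_congr_ae (Eventually.of_forall fun y => ?_)
    by_cases hy : y ∈ E <;> simp [hy]
  obtain ⟨K, hK, hKg⟩ := exists_measurable_kernel_of_factor (weighted μ w) (weighted μ w)
    (fun x => g x) (fun x => g' x) _ (fun x => hint _) (fun x => hbound _ (hC x)) (hmeas B g hg)
    (fun x => hint _) (fun x => hbound _ (hC' x)) (hmeas B' g' hg') (fun f hf ⟨c, hc⟩ h0 x => by
      have hfL := hw.memLp_mul (μ := μ) hr1 hr (f := fun y => (f y : ℂ)) (by fun_prop) (c := c)
        (fun y => by simpa using hc y)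
      have hsm : ∀ u : Lp ℂ r' μ,
          ∫ y, f y • u y ∂weighted μ w = pairing r' (hfL.toLp _) u := fun u => by
        rw [hpair]; simp
      simp only [hsm] at h0 ⊢
      refine hker _ ((Lp.eq_zero_iff_ae_eq_zero).2 ?_) x
      exact (hg _).symm.trans (hw.ae_weighted_iff.1 h0))
  refine ⟨K, hK, ?_⟩
  rw [← hw.ae_weighted_iff]
  filter_upwards [hKg] with x hx
  exact hw.ae_weighted_iff.1 hx

end JointMeasurability

/-! ### The heat kernel -/

section Main

variable {X : Type*} [EMetricSpace X] [MeasurableSpace X] {μ : Measure X} [SigmaFinite μ]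
  {r r' : ℝ≥0∞} [Fact (1 ≤ r)] [Fact (1 ≤ r')] [ENNReal.HolderConjugate r r']

/-- The dual operator applied to an element of its graph. -/
theorem dualOp_apply {X : Type*} [MeasurableSpace X] {μ : Measure X} [SigmaFinite μ]
    {r r' : ℝ≥0∞} [Fact (1 ≤ r)] [Fact (1 ≤ r')] [ENNReal.HolderConjugate r r']
    (A : Lp ℂ r μ →ₗ.[ℂ] Lp ℂ r μ) (hA : Dense (A.domain : Set (Lp ℂ r μ)))
    {g h : Lp ℂ r' μ} (hgh : (g, h) ∈ dualGraph r' A) :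
    ∃ hg : g ∈ (dualOp r' A).domain, dualOp r' A ⟨g, hg⟩ = h := by
  rw [← dualOp_graph r' A hA] at hgh
  have hg := LinearPMap.mem_domain_of_mem_graph hgh
  exact ⟨hg, (dualOp r' A).mem_graph_snd_inj ((dualOp r' A).mem_graph ⟨g, hg⟩) hgh rfl⟩

/-- The jointly measurable function agreeing with `K` on the sections where `K` is a version of `g`
and with the chosen representatives of `g` on the others. -/
theorem exists_version {X : Type*} [MeasurableSpace X] {μ : Measure X} [SigmaFinite μ]
    (g : X → X → ℂ) (K : X × X → ℂ) (hK : Measurable K)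
    (hKg : ∀ᵐ x ∂μ, (fun y => K (x, y)) =ᵐ[μ] g x) :
    ∃ p : X → X → ℂ, NullMeasurable (fun z : X × X => p z.1 z.2) (μ.prod μ) ∧
      ∀ x, g x =ᵐ[μ] p x := by
  classical
  refine ⟨fun x => if (fun y => K (x, y)) =ᵐ[μ] g x then fun y => K (x, y) else g x, ?_,
    fun x => ?_⟩
  · refine hK.nullMeasurable.congr ?_
    filter_upwards [Measure.quasiMeasurePreserving_fst.ae hKg] with z hz
    simp [hz]
  · by_cases h : (fun y => K (x, y)) =ᵐ[μ] g x
    · simpa [h] using h.symm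
    · simp [h]

/-- The kernel at a fixed time `t`, with an explicit Hölder constant. The functionals
`f ↦ J (T t f) x` and `f ↦ J (A T t f) x` are represented by `g x` and `A' (g x)`; joint
measurability comes from the factorization of `T t` through `T (t / 2)`. Here `S`, `T` and `D` stand
for `T (t / 2)`, `T t` and `A T t`, and `Q`, `P` and `R` for their compositions with `L = A ^ k`. -/
theorem exists_kernel_at (hr : r ≠ ∞) (A : Lp ℂ r μ →ₗ.[ℂ] Lp ℂ r μ)
    (hA : Dense (A.domain : Set (Lp ℂ r μ))) (L : Lp ℂ r μ →ₗ.[ℂ] Lp ℂ r μ) {α : ℝ≥0} (hα : 0 < α)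
    (J : L.domain →ₗ[ℂ] (X → ℂ)) {M : ℝ≥0} (hM : 0 < M)
    (hJ : ∀ f : L.domain, J f =ᵐ[μ] ((f : Lp ℂ r μ) : X → ℂ) ∧
      holderENorm α (J f) ≤ (M : ℝ≥0∞) * ENNReal.ofReal (graphNorm L f))
    (S Q T P D R : Lp ℂ r μ →L[ℂ] Lp ℂ r μ) (hST : ∀ f, S f = 0 → T f = 0)
    (hSQ : ∀ f, (S f, Q f) ∈ L.graph) (hTP : ∀ f, (T f, P f) ∈ L.graph)
    (hDR : ∀ f, (D f, R f) ∈ L.graph) (hTD : ∀ f g, (f, g) ∈ A.graph → T g = D f)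
    {a b : ℝ} (ha : 0 < a) (hb : 0 < b) (hPa : ‖T‖ + ‖P‖ ≤ a) (hRb : ‖D‖ + ‖R‖ ≤ b) :
    ∃ (p : X → X → ℂ) (G : X → (dualOp r' A).domain),
      NullMeasurable (fun z : X × X => p z.1 z.2) (μ.prod μ) ∧
      (∀ f : Lp ℂ r μ, (∀ᵐ x ∂μ, Integrable (fun y => p x y * f y) μ) ∧
        T f =ᵐ[μ] fun x => ∫ y, p x y * f y ∂μ) ∧
      (∀ x, ((G x : Lp ℂ r' μ) : X → ℂ) =ᵐ[μ] p x) ∧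
      ∀ x x', ENNReal.ofReal (graphNorm (dualOp r' A) (G x - G x')) ≤
        ENNReal.ofReal (M * (a + b)) * edist x x' ^ (α : ℝ) := by
  have hJ' := fun f => (hJ f).2
  have hdom : ∀ {B P : Lp ℂ r μ →L[ℂ] Lp ℂ r μ}, (∀ f, (B f, P f) ∈ L.graph) →
      ∀ f, B f ∈ L.domain := fun h f => LinearPMap.mem_domain_of_mem_graph (h f)
  obtain ⟨g, hg, hgn, hgd⟩ := exists_dual_evaluation (r' := r') hr hα J hM hJ' T P hTP ha hPa
  obtain ⟨h, hh, -, hhd⟩ := exists_dual_evaluation (r' := r') hr hα J hM hJ' D R hDR hb hRb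
  obtain ⟨s, hs, hsn, -⟩ := exists_dual_evaluation (r' := r') hr hα J hM hJ' S Q hSQ
    (c := ‖S‖ + ‖Q‖ + 1) (by positivity) (by linarith)
  have hae : ∀ {B : Lp ℂ r μ →L[ℂ] Lp ℂ r μ} (hB : ∀ f, B f ∈ L.domain) {g : X → Lp ℂ r' μ},
      (∀ f (h : B f ∈ L.domain) x, pairing r' f (g x) = J ⟨B f, h⟩ x) →
      ∀ f, (fun x => pairing r' f (g x)) =ᵐ[μ] B f := fun hB g hg f => by
    filter_upwards [(hJ ⟨_, hB f⟩).1] with x hx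
    rw [hg f (hB f), hx]
  obtain ⟨K, hK, hKg⟩ := exists_jointly_measurable hr S T s g
    (max (M * (‖S‖ + ‖Q‖ + 1)) (M * a)) (fun x => (hsn x).trans (le_max_left _ _))
    (fun x => (hgn x).trans (le_max_right _ _)) (hae (hdom hSQ) hs) (hae (hdom hTP) hg)
    (fun f hf x => by
      rw [hg f (hdom hTP f)]
      have : (⟨T f, hdom hTP f⟩ : L.domain) = 0 := Subtype.ext (hST f hf)
      rw [this, map_zero]; rfl)
  obtain ⟨p, hp, hgp⟩ := exists_version (fun x => g x) K hK hKg
  have hgh : ∀ x, (g x, h x) ∈ dualGraph r' A := fun x f => by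
    have h1 := hTD f (A f) (A.mem_graph f)
    rw [hg (A f) (hdom hTP _), hh (f : Lp ℂ r μ) (hdom hDR _)]
    have h2 : (⟨T (A f), hdom hTP _⟩ : L.domain) = ⟨D f, hdom hDR _⟩ := Subtype.ext h1
    rw [h2]
  choose hgA hgA' using fun x => dualOp_apply A hA (hgh x)
  refine ⟨p, fun x => ⟨g x, hgA x⟩, hp, fun f => ⟨Eventually.of_forall fun x => ?_, ?_⟩, hgp,
    fun x x' => ?_⟩
  · refine (integrable_mul_of_Lp (g x) f).congr ?_
    filter_upwards [hgp x] with y hy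
    rw [hy]
  · filter_upwards [hae (hdom hTP) hg f] with x hx
    rw [← hx, pairing_eq]
    refine integral_congr_ae ?_
    filter_upwards [hgp x] with y hy
    rw [hy, mul_comm]
  · rw [graphNorm, LinearPMap.map_sub, hgA', hgA', ENNReal.ofReal_add (norm_nonneg _)
      (norm_nonneg _), mul_add, ENNReal.ofReal_add (by positivity) (by positivity), add_mul]
    exact add_le_add (hgd x x') (hhd x x')

end Main

end HeatKernel

end

theorem mainTheorem4 {X : Type*} [EMetricSpace X] [MeasurableSpace X]
    (μ : Measure X) [SigmaFinite μ]
    (r r' : ℝ≥0∞) [Fact (1 ≤ r)] [Fact (1 ≤ r')] [ENNReal.HolderConjugate r r'] (hr : r ≠ ∞)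
    (A : Lp ℂ r μ →ₗ.[ℂ] Lp ℂ r μ) (T : ℝ → Lp ℂ r μ →L[ℂ] Lp ℂ r μ)
    (hT : HeatKernel.IsC0Semigroup T) (hAT : HeatKernel.IsGenerator A T)
    (hTa : HeatKernel.IsBoundedAnalytic T)
    (k : ℕ) (hk : 1 ≤ k) (α : ℝ≥0) (hα : 0 < α) (hα1 : α ≤ 1)
    (hemb : HeatKernel.EmbedsInHolder (HeatKernel.opPow A k) α) :
    ∃ p : ℝ → X → X → ℂ, HeatKernel.IsHeatKernel T p ∧
      ∃ G : ℝ → X → (HeatKernel.dualOp r' A).domain,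
        (∀ t : ℝ, 0 < t → ∀ x : X, ((G t x : Lp ℂ r' μ) : X → ℂ) =ᵐ[μ] p t x) ∧
        ∃ C₁ C₂ : ℝ, 0 < C₁ ∧ 0 < C₂ ∧ ∀ t : ℝ, 0 < t → ∀ x x' : X,
          ENNReal.ofReal (HeatKernel.graphNorm (HeatKernel.dualOp r' A) (G t x - G t x')) ≤
            ENNReal.ofReal (C₁ + C₂ * t ^ (-((k : ℤ) + 1))) * edist x x' ^ (α : ℝ) := by
  obtain ⟨J, M₀, hJ₀⟩ := hemb
  obtain ⟨N, hN, hsm⟩ := HeatKernel.exists_smoothing A T hT hAT hTa k hk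
  have hA := HeatKernel.dense_domain A T hT hAT hTa
  -- a strictly positive embedding constant keeps the bound meaningful at infinite distance
  set M : ℝ≥0 := M₀ + 1 with hM
  have hM0 : 0 < M := by positivity
  have hJ : ∀ f : (HeatKernel.opPow A k).domain, J f =ᵐ[μ] ((f : Lp ℂ r μ) : X → ℂ) ∧
      HeatKernel.holderENorm α (J f) ≤
        (M : ℝ≥0∞) * ENNReal.ofReal (HeatKernel.graphNorm (HeatKernel.opPow A k) f) := fun f =>
    ⟨(hJ₀ f).1, (hJ₀ f).2.trans (by gcongr; exact le_self_add)⟩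
  have hex : ∀ t : ℝ, ∃ (p : X → X → ℂ) (G : X → (HeatKernel.dualOp r' A).domain), 0 < t →
      (NullMeasurable (fun z : X × X => p z.1 z.2) (μ.prod μ) ∧
        ∀ f : Lp ℂ r μ, (∀ᵐ x ∂μ, Integrable (fun y => p x y * f y) μ) ∧
          T t f =ᵐ[μ] fun x => ∫ y, p x y * f y ∂μ) ∧
      (∀ x, ((G x : Lp ℂ r' μ) : X → ℂ) =ᵐ[μ] p x) ∧
      ∀ x x', ENNReal.ofReal (HeatKernel.graphNorm (HeatKernel.dualOp r' A) (G x - G x')) ≤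
        ENNReal.ofReal (3 * M * N + 3 * M * N * t ^ (-((k : ℤ) + 1))) * edist x x' ^ (α : ℝ) := by
    intro t
    by_cases ht : 0 < t
    · obtain ⟨-, Q, -, -, hQ, -, -⟩ := hsm (t / 2) (by positivity)
      obtain ⟨hTN, P, D, R, hP, hPn, hD, hDn, hR, hRn⟩ := hsm t ht
      obtain ⟨p, G, h1, h2, h3, h4⟩ := HeatKernel.exists_kernel_at (r' := r') hr A hA _ hα J hM0 hJ
        (T (t / 2)) Q (T t) P D R (fun f hf => by
          have := hT.add (t / 2) (t / 2) (by positivity) (by positivity)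
          rw [add_halves] at this
          rw [this, ContinuousLinearMap.comp_apply, hf, map_zero])
        hQ hP hR hD (a := N + N / t ^ k) (b := N / t + N / t ^ (k + 1)) (by positivity)
        (by positivity) (add_le_add hTN hPn) (add_le_add hDn hRn)
      refine ⟨p, G, fun _ => ⟨⟨h1, h2⟩, h3, fun x x' => (h4 x x').trans ?_⟩⟩
      gcongr
      -- intermediate powers of `1 / t` are bounded by the extreme ones
      have hpow : ∀ j ≤ k + 1, (t⁻¹) ^ j ≤ 1 + (t⁻¹) ^ (k + 1) := fun j hj => by
        rcases le_total t⁻¹ 1 with h | h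
        · exact (pow_le_one₀ (by positivity) h).trans (le_add_of_nonneg_right (by positivity))
        · exact (pow_le_pow_right₀ h hj).trans (le_add_of_nonneg_left zero_le_one)
      have hz : t ^ (-((k : ℤ) + 1)) = (t⁻¹) ^ (k + 1) := by
        rw [zpow_neg, inv_pow]; norm_cast
      have e1 := hpow k (by omega)
      have e2 := hpow 1 (by omega)
      rw [pow_one] at e2
      have hMN : 0 < (M : ℝ) * N := by positivity
      rw [hz]
      simp only [div_eq_mul_inv, ← inv_pow]
      nlinarith [mul_le_mul_of_nonneg_left e1 hMN.le, mul_le_mul_of_nonneg_left e2 hMN.le]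
    · exact ⟨0, 0, fun h => absurd h ht⟩
  choose p G hpG using hex
  exact ⟨p, fun t ht => (hpG t ht).1, G, fun t ht => (hpG t ht).2.1, 3 * M * N, 3 * M * N,
    by positivity, by positivity, fun t ht => (hpG t ht).2.2⟩
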